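/- Let $\Delta\ge 1$, $\sigma>0$, $q=(1,2,\dots,\Delta)^\top$, and let $p_1,p_2$ be probability mass functions on $\{1,\dots,\Delta\}$ with all entries strictly positive. Let $S_1,S_2,\dots\in\{1,2\}$ be the random state sequence that starts in state 1 and alternates between phases of state 1 and phases of state 2, all phase durations being independent and the durations of state-$m$ phases having law $p_m$. For $t\ge1$ let $\mathcal S^t$ be the set of sequences $s^t\in\{1,2\}^t$ with $\mathbb P(S^t=s^t)>0$, and $C_t=|\mathcal S^t|$. For $s^t\in\mathcal S^t$ let $N_{m,d}(s^t)$ be the number of state-$m$ phases (maximal runs of state $m$) of length $d$ in $s^t$, let $V(s^t)=(N_{m,d}(s^t)/t)_{m\in\{1,2\},\,1\le d\le\Delta}\in\mathbb R^{2\times\Delta}$ be its type, and let $\Theta_2(s^t)=\frac1t|\{k\le t:s_k=2\}|$. For each $t$ let $\{\mathcal Z_{s^t}:s^t\in\mathcal S^t\}$ be independent Gaussian random variables on a common probability space $(\Omega,\mathcal F,\mathbb P)$ (no assumption is made on the joint law for different $t$), with $\mathcal Z_{s^t}\sim\mathcal N(0,\sigma^2\Theta_2(s^t)/t)$, and let $$Q_t^{\mathcal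 Z}(B)=\frac{1}{C_t}\,\bigl|\{s^t\in\mathcal S^t:(V(s^t),\mathcal Z_{s^t})\in B\}\bigr|,\qquad B\in\mathcal B(\mathbb R^{2\Delta+1}).$$ Let $\psi$ be the unique positive zero of $x^\Delta-x^{\Delta-1}-\dots-x-1$, let $$\mathcal V=\{\nu=(\nu_1,\nu_2)\in\mathbb R_+^{2\times\Delta}:\ \mathbb 1^\top\nu_1=\mathbb 1^\top\nu_2,\ q^\top\nu_1+q^\top\nu_2=1\},$$ $$H(\lambda)=-\sum_{d=1}^{\Delta}\lambda_d\log\frac{\lambda_d}{\mathbb 1^\top\lambda}\quad(\lambda\in\mathbb R_+^\Delta,\ 0\log 0=0),\qquad J_\nu(\xi)=\frac{\xi^2}{2\sigma^2\,q^\top\nu_2},$$ and let $I:\mathbb R^{2\Delta+1}\to[0,+\infty]$ be given by $$I(\nu,\xi)=\log\psi-H(\nu_1)-H(\nu_2)+J_\nu(\xi)\quad\text{if }\nu\in\mathcal V\text{ and }H(\nu_1)+H(\nu_2)\ge J_\nu(\xi),$$ and $I(\nu,\xi)=+\infty$ otherwise (for $\sigma=1$, $J_\nu(\xi)=\xi^2/(2q^\top\nu_2)$).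 Then $I$ is a rate function (nonnegative and lower semicontinuous), and the random measures $Q_t^{\mathcal Z}$ satisfy with probability one the large deviations principle with rate function $I$: for every closed $F\subseteq\mathbb R^{2\Delta+1}$, almost surely $$\limsup_{t\to\infty}\frac1t\log Q_t^{\mathcal Z}(F)\le-\inf_{x\in F}I(x),$$ and for every open $E\subseteq\mathbb R^{2\Delta+1}$, almost surely $$\liminf_{t\to\infty}\frac1t\log Q_t^{\mathcal Z}(E)\ge-\inf_{x\in E}I(x).$$ -/

import Mathlib

open MeasureTheory ProbabilityTheory Filter

noncomputable section

namespace RandomDuration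

/-! States: `0 : Fin 2` is state 1 and `1 : Fin 2` is state 2. A state sequence of length `t` is a
map `Fin t → Fin 2`; the index `k` stands for the time `k + 1`. An index `d : Fin Δ` stands for the
duration `d + 1 ∈ {1, …, Δ}`. -/

/-- The state during the `i`-th phase (`i = 0, 1, 2, …`): phases alternate, starting in state 1. -/
def phaseState (i : ℕ) : Fin 2 := if Even i then 0 else 1

/-- The switching time `T_i`: the sum of the first `i` phase durations. -/
def switchTime {Δ t : ℕ} (D : Fin t → Fin Δ) (i : ℕ) : ℕ :=
  ∑ j : Fin t, if (j : ℕ) < i then (D j : ℕ) + 1 else 0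

/-- `s` is the state sequence whose consecutive phase durations are given by `D`. Every phase lasts
at least one time unit, so the first `t` phases determine the states up to time `t`. -/
def Generates {Δ t : ℕ} (D : Fin t → Fin Δ) (s : Fin t → Fin 2) : Prop :=
  ∀ i k : Fin t, switchTime D i ≤ k → (k : ℕ) < switchTime D ((i : ℕ) + 1) → s k = phaseState i

open Classical in
/-- The probability that the first `t` states are `s`, when the durations of all phases are
independent and those of the state-`m` phases have probability mass function `p m`. -/
def seqProb {Δ : ℕ} (p : Fin 2 → Fin Δ → ℝ) {t : ℕ} (s : Fin t → Fin 2) : ℝ :=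
  ∑ D : Fin t → Fin Δ with Generates D s, ∏ i : Fin t, p (phaseState i) (D i)

open Classical in
/-- The set of feasible state sequences of length `t`: those of positive probability. -/
def feasible {Δ : ℕ} (p : Fin 2 → Fin Δ → ℝ) (t : ℕ) : Finset (Fin t → Fin 2) :=
  Finset.univ.filter fun s => 0 < seqProb p s

/-- `s` has a state-`m` phase (a maximal run of state `m`) of length `d` occupying the indices
`a, …, a + d - 1`. -/
def IsPhase {t : ℕ} (s : Fin t → Fin 2) (m : Fin 2) (a d : ℕ) : Prop :=
  a + d ≤ t ∧ (∀ k : Fin t, a ≤ k → (k : ℕ) < a + d → s k = m) ∧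
    (∀ k : Fin t, (k : ℕ) + 1 = a → s k ≠ m) ∧ (∀ k : Fin t, (k : ℕ) = a + d → s k ≠ m)

open Classical in
/-- The number of state-`m` phases of length `d` in `s` (for `d ≥ 1`). -/
def phaseCount {t : ℕ} (s : Fin t → Fin 2) (m : Fin 2) (d : ℕ) : ℕ :=
  ((Finset.range t).filter fun a => IsPhase s m a d).card

/-- The type `V(s)` of a state sequence: phase counts normalized by `t`. -/
def seqType (Δ : ℕ) {t : ℕ} (s : Fin t → Fin 2) : Fin 2 → Fin Δ → ℝ :=
  fun m d => (phaseCount s m ((d : ℕ) + 1) : ℝ) / t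

/-- The fraction of time that `s` spends in state 2. -/
def fracState2 {t : ℕ} (s : Fin t → Fin 2) : ℝ :=
  ((Finset.univ.filter fun k => s k = 1).card : ℝ) / t

/-- `qᵀ l` for `q = (1, 2, …, Δ)`. -/
def qDot {Δ : ℕ} (l : Fin Δ → ℝ) : ℝ := ∑ d : Fin Δ, (((d : ℕ) : ℝ) + 1) * l d

/-- The limiting set of types. -/
def typeSet (Δ : ℕ) : Set (Fin 2 → Fin Δ → ℝ) :=
  {ν | (∀ m d, 0 ≤ ν m d) ∧ ∑ d, ν 0 d = ∑ d, ν 1 d ∧ qDot (ν 0) + qDot (ν 1) = 1}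

/-- The entropy `H(l) = - ∑ l_d log (l_d / ∑ l)` of a nonnegative vector, which is the exponential
growth rate in `t` of the multinomial coefficient `(t ∑ l)! / ∏ (t l_d)!`. -/
def entropy {Δ : ℕ} (l : Fin Δ → ℝ) : ℝ := -∑ d, l d * Real.log (l d / ∑ e, l e)

/-- `J_ν(ξ) = ξ² / (2 σ² qᵀν₂)`. -/
def gaussRate {Δ : ℕ} (σ : ℝ) (ν : Fin 2 → Fin Δ → ℝ) (ξ : ℝ) : ℝ :=
  ξ ^ 2 / (2 * σ ^ 2 * qDot (ν 1))

open Classical in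
/-- The rate function `I(ν, ξ)`. -/
def rate {Δ : ℕ} (ψ σ : ℝ) (x : (Fin 2 → Fin Δ → ℝ) × ℝ) : EReal :=
  if x.1 ∈ typeSet Δ ∧ gaussRate σ x.1 x.2 ≤ entropy (x.1 0) + entropy (x.1 1) then
    ((Real.log ψ - entropy (x.1 0) - entropy (x.1 1) + gaussRate σ x.1 x.2 : ℝ) : EReal)
  else ⊤

/-- The empirical measure of `(V(s), z s)` for `s` uniform on the feasible sequences of
length `t`. -/
def empMeasure {Δ : ℕ} (p : Fin 2 → Fin Δ → ℝ) (t : ℕ) (z : (Fin t → Fin 2) → ℝ) :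
    Measure ((Fin 2 → Fin Δ → ℝ) × ℝ) :=
  ((feasible p t).card : ENNReal)⁻¹ • ∑ s ∈ feasible p t, Measure.dirac (seqType Δ s, z s)

/-- The random measures `Q t ω`, `t = 1, 2, …`, satisfy the large deviations principle with
probability one, with rate function `I`. -/
structure SatisfiesLDPAlmostSurely {Ω X : Type*} [MeasurableSpace Ω] [TopologicalSpace X]
    [MeasurableSpace X] (P : Measure Ω) (Q : ℕ → Ω → Measure X) (I : X → EReal) : Prop where
  nonneg : ∀ x, 0 ≤ I x
  lowerSemicontinuous : LowerSemicontinuous I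
  upper : ∀ F : Set X, IsClosed F → ∀ᵐ ω ∂P,
    limsup (fun t : ℕ => ENNReal.log (Q t ω F) / (t : EReal)) atTop ≤ -(⨅ x ∈ F, I x)
  lower : ∀ E : Set X, IsOpen E → ∀ᵐ ω ∂P,
    -(⨅ x ∈ E, I x) ≤ liminf (fun t : ℕ => ENNReal.log (Q t ω E) / (t : EReal)) atTop

end RandomDuration

end

/-! A feasible sequence is, up to its last phase, determined by its phase durations, so duration
laws `π` give it probability `exp (-(t * crossEntropy ν π))` up to a constant factor, where `ν` is
its type. With `π d = ψ ^ (-d)` all feasible sequences get the same weight, hence there are about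
`ψ ^ t` of them. With `π` the phase laws of `ν` itself, Gibbs' inequality concentrates the mass on
types close to `ν`, hence about `exp (t * H)` sequences have such a type, where
`H = H(ν₁) + H(ν₂)`.

Each of these hits a small neighbourhood of `ξ` with probability about `exp (-(t * J))`, where
`J = J_ν(ξ)`, so the expected number of hits is about `exp (t * (H - J))`. If `J > H`, by Markov's
inequality and the Borel–Cantelli lemma there are almost surely no hits for large `t`, which is
why the rate is infinite there. If `J < H`, Markov's inequality bounds the number of hits from
above and Chebyshev's from below. Exponential tightness reduces closed sets to compact ones, and
these are covered by finitely many small neighbourhoods. -/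

noncomputable section

namespace RandomDuration

open Topology

section Phases

variable {Δ t : ℕ} {D D' : Fin t → Fin Δ} {s : Fin t → Fin 2} {n : ℕ}

theorem phaseState_succ_ne (i : ℕ) : phaseState (i + 1) ≠ phaseState i := by
  by_cases h : Even i <;> simp [phaseState, Nat.even_add_one, h]

theorem switchTime_zero (D : Fin t → Fin Δ) : switchTime D 0 = 0 := by
  simp [switchTime]

theorem switchTime_succ (D : Fin t → Fin Δ) (i : Fin t) :
    switchTime D (i + 1) = switchTime D i + (D i + 1) := by
  have h (j : Fin t) : (if (j : ℕ) < i + 1 then (D j : ℕ) + 1 else 0) =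
      (if (j : ℕ) < i then (D j : ℕ) + 1 else 0) + if j = i then (D j : ℕ) + 1 else 0 := by
    rcases lt_trichotomy j i with hj | rfl | hj
    · simp [hj.ne, Fin.lt_def.1 hj, Nat.lt_succ_of_lt (Fin.lt_def.1 hj)]
    · simp
    · simp [hj.ne', (Fin.lt_def.1 hj).le.not_gt, (Fin.lt_def.1 hj).not_ge]
  unfold switchTime
  simp_rw [h, Finset.sum_add_distrib]
  simp

theorem monotone_switchTime (D : Fin t → Fin Δ) : Monotone (switchTime D) := by
  refine fun i j h => Finset.sum_le_sum fun k _ => ?_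
  split_ifs <;> omega

theorem strictMonoOn_switchTime (D : Fin t → Fin Δ) : StrictMonoOn (switchTime D) (Set.Iic t) := by
  intro i _ j hj hij
  have hit : i < t := hij.trans_le hj
  calc switchTime D i < switchTime D (i + 1) := by
        have := switchTime_succ D ⟨i, hit⟩
        simp only at this
        omega
    _ ≤ switchTime D j := monotone_switchTime D hij

theorem le_switchTime (D : Fin t → Fin Δ) {i : ℕ} (hi : i ≤ t) : i ≤ switchTime D i := by
  induction i with
  | zero => exact Nat.zero_le _
  | succ i ih =>
    exact (ih (by omega)).trans_lt
      (strictMonoOn_switchTime D (Set.mem_Iic.2 (by omega)) hi (Nat.lt_succ_self i))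

theorem switchTime_congr {i : ℕ} (h : ∀ j : Fin t, (j : ℕ) < i → D j = D' j) :
    switchTime D i = switchTime D' i :=
  Finset.sum_congr rfl fun j _ => by
    split_ifs with hj
    · rw [h j hj]
    · rfl

theorem exists_switchTime_le_lt (D : Fin t → Fin Δ) (k : Fin t) :
    ∃ i : Fin t, switchTime D i ≤ k ∧ (k : ℕ) < switchTime D (i + 1) := by
  let i := Nat.findGreatest (fun i => switchTime D i ≤ k) t
  have hi : switchTime D i ≤ k :=
    Nat.findGreatest_spec (P := fun i => switchTime D i ≤ k) (Nat.zero_le t)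
      (by rw [switchTime_zero]; exact Nat.zero_le _)
  have hit : i < t := (monotone_switchTime D).reflect_lt
    ((hi.trans_lt k.2).trans_le (le_switchTime D le_rfl))
  exact ⟨⟨i, hit⟩, hi, not_le.1 fun h =>
    (Nat.lt_succ_self i).not_ge (Nat.le_findGreatest hit h)⟩

theorem eq_of_switchTime_le_lt {i j k : ℕ} (hi : switchTime D i ≤ k)
    (hi' : k < switchTime D (i + 1)) (hj : switchTime D j ≤ k) (hj' : k < switchTime D (j + 1)) :
    i = j :=
  le_antisymm (Nat.lt_succ_iff.1 ((monotone_switchTime D).reflect_lt (hi.trans_lt hj')))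
    (Nat.lt_succ_iff.1 ((monotone_switchTime D).reflect_lt (hj.trans_lt hi')))

theorem existsUnique_generates (D : Fin t → Fin Δ) : ∃! s, Generates D s := by
  choose i hi hi' using exists_switchTime_le_lt D
  refine ⟨fun k => phaseState (i k), fun j k h h' => ?_, fun s hs => funext fun k => ?_⟩
  · simp only [eq_of_switchTime_le_lt h h' (hi k) (hi' k)]
  · exact hs (i k) k (hi k) (hi' k)

theorem Generates.switchTime_succ_le (h : Generates D s) (h' : Generates D' s) {j : ℕ}
    (hj : switchTime D j = switchTime D' j) (hlt : switchTime D (j + 1) < t) :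
    switchTime D' (j + 1) ≤ switchTime D (j + 1) := by
  by_contra! hgt
  have hjt : j + 1 < t := by
    by_contra! ht
    exact ((le_switchTime D le_rfl).trans (monotone_switchTime D ht)).not_gt hlt
  have hnext : s ⟨_, hlt⟩ = phaseState (j + 1) := h ⟨j + 1, hjt⟩ ⟨_, hlt⟩ le_rfl
    (strictMonoOn_switchTime D hjt.le (Set.mem_Iic.2 hjt) (Nat.lt_succ_self _))
  have hsame : s ⟨_, hlt⟩ = phaseState j := h' ⟨j, by omega⟩ ⟨_, hlt⟩
    (hj ▸ monotone_switchTime D (Nat.le_succ j)) hgt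
  exact phaseState_succ_ne j (hnext.symm.trans hsame)

/-- `s` consists of exactly `n` phases, the durations of which are the first `n` entries of `D`;
the last phase ends at time `t`, whereas `Generates` allows it to be cut off. -/
structure IsPhaseDecomposition (D : Fin t → Fin Δ) (n : ℕ) (s : Fin t → Fin 2) : Prop where
  generates : Generates D s
  le : n ≤ t
  switchTime_eq : switchTime D n = t

theorem Generates.exists_isPhaseDecomposition (h : Generates D s) :
    ∃ D' : Fin t → Fin Δ, ∃ n, IsPhaseDecomposition D' n s := by
  rcases t.eq_zero_or_pos with rfl | ht
  · exact ⟨D, 0, h, le_rfl, switchTime_zero D⟩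
  obtain ⟨i, hi, hi'⟩ := exists_switchTime_le_lt D ⟨t - 1, by omega⟩
  simp only [switchTime_succ] at hi hi'
  let D' := Function.update D i ⟨t - switchTime D i - 1, by have := (D i).2; omega⟩
  have hcongr {j : ℕ} (hj : j ≤ i) : switchTime D' j = switchTime D j :=
    switchTime_congr fun k hk => Function.update_of_ne (Fin.ne_of_lt (hk.trans_le hj)) _ _
  have hend : switchTime D' (i + 1) = t := by
    have hD' : (D' i : ℕ) = t - switchTime D i - 1 := by simp [D']
    rw [switchTime_succ, hcongr le_rfl, hD']
    omega
  refine ⟨D', i + 1, fun j k hj hj' => ?_, i.2, hend⟩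
  have hji : (j : ℕ) ≤ i := Nat.lt_succ_iff.1
    ((monotone_switchTime D').reflect_lt (hj.trans_lt (k.2.trans_eq hend.symm)))
  refine h j k (hcongr hji ▸ hj) ?_
  rcases hji.eq_or_lt with hji | hji
  · rw [hji, switchTime_succ]; omega
  · rwa [← hcongr hji]

theorem exists_isPhaseDecomposition_of_mem_feasible {p : Fin 2 → Fin Δ → ℝ}
    (hs : s ∈ feasible p t) : ∃ D : Fin t → Fin Δ, ∃ n, IsPhaseDecomposition D n s := by
  classical
  rw [feasible, Finset.mem_filter, seqProb] at hs
  obtain ⟨D, hD, -⟩ := Finset.exists_ne_zero_of_sum_ne_zero hs.2.ne'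
  exact (Finset.mem_filter.1 hD).2.exists_isPhaseDecomposition

theorem IsPhase.left_le_left {m m' : Fin 2} {a d a' d' k : ℕ} (h : IsPhase s m a d)
    (h' : IsPhase s m' a' d') (hk : a ≤ k) (hk' : k < a + d) (hk₂ : a' ≤ k)
    (hk₂' : k < a' + d') : a ≤ a' := by
  by_contra! hlt
  have hkt : k < t := hk'.trans_le h.1
  have hmm : m = m' := (h.2.1 ⟨k, hkt⟩ hk hk').symm.trans (h'.2.1 ⟨k, hkt⟩ hk₂ hk₂')
  refine h.2.2.1 ⟨a - 1, by omega⟩ (by simp; omega) ?_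
  rw [hmm]
  exact h'.2.1 _ (by simp; omega) (by simp; omega)

theorem IsPhase.right_le_right {m m' : Fin 2} {a d a' d' k : ℕ} (h : IsPhase s m a d)
    (h' : IsPhase s m' a' d') (hk : a ≤ k) (hk' : k < a + d) (hk₂ : a' ≤ k)
    (hk₂' : k < a' + d') : a' + d' ≤ a + d := by
  by_contra! hlt
  have hkt : k < t := hk'.trans_le h.1
  have hmm : m = m' := (h.2.1 ⟨k, hkt⟩ hk hk').symm.trans (h'.2.1 ⟨k, hkt⟩ hk₂ hk₂')
  refine h.2.2.2 ⟨a + d, hlt.trans_le h'.1⟩ rfl ?_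
  rw [hmm]
  exact h'.2.1 _ (by simp; omega) hlt

namespace IsPhaseDecomposition

variable (h : IsPhaseDecomposition D n s)

include h

theorem isPhase {j : Fin t} (hj : (j : ℕ) < n) :
    IsPhase s (phaseState j) (switchTime D j) (D j + 1) := by
  have hle : switchTime D (j + 1) ≤ t :=
    (monotone_switchTime D hj).trans_eq h.switchTime_eq
  rw [IsPhase, ← switchTime_succ]
  refine ⟨hle, h.generates j, fun k hk => ?_, fun k hk => ?_⟩
  · obtain ⟨i, hi⟩ : ∃ i, (j : ℕ) = i + 1 := Nat.exists_eq_succ_of_ne_zero fun h0 => by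
      rw [h0, switchTime_zero] at hk
      omega
    have hlt : switchTime D i < switchTime D (i + 1) :=
      strictMonoOn_switchTime D (Set.mem_Iic.2 (by omega)) (Set.mem_Iic.2 (by omega)) (by omega)
    rw [hi] at hk ⊢
    rw [h.generates ⟨i, by omega⟩ k (by simp; omega) (by simp; omega)]
    exact (phaseState_succ_ne i).symm
  · have hjn : (j : ℕ) + 1 < n := (monotone_switchTime D).reflect_lt (by
      rw [h.switchTime_eq]; omega)
    have hjt : (j : ℕ) + 1 < t := hjn.trans_le h.le
    rw [h.generates ⟨j + 1, hjt⟩ k hk.ge (hk.trans_lt (strictMonoOn_switchTime D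
      hjt.le (Set.mem_Iic.2 hjt) (Nat.lt_succ_self _)))]
    exact phaseState_succ_ne j

theorem lt_of_switchTime_le {i : ℕ} (k : Fin t) (hi : switchTime D i ≤ k) : i < n :=
  (monotone_switchTime D).reflect_lt (hi.trans_lt (k.2.trans_eq h.switchTime_eq.symm))

theorem isPhase_iff {m : Fin 2} {a : ℕ} {d : Fin Δ} :
    IsPhase s m a (d + 1) ↔
      ∃ j : Fin t, ((j : ℕ) < n ∧ phaseState j = m ∧ D j = d) ∧ switchTime D j = a := by
  refine ⟨fun hp => ?_, ?_⟩
  · have hat : a < t := by have := hp.1; omega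
    obtain ⟨j, hj, hj'⟩ := exists_switchTime_le_lt D ⟨a, hat⟩
    have hjn := h.lt_of_switchTime_le _ hj
    have hq := h.isPhase hjn
    simp only [switchTime_succ] at hj hj'
    have hleft := hp.left_le_left hq le_rfl (by omega) hj hj'
    have hright := hp.right_le_right hq le_rfl (by omega) hj hj'
    have hright' := hq.right_le_right hp hj hj' le_rfl (by omega)
    exact ⟨j, ⟨hjn, (h.generates j ⟨a, hat⟩ hj (by rwa [switchTime_succ])).symm.trans
      (hp.2.1 ⟨a, hat⟩ le_rfl (by simp)), Fin.ext (by omega)⟩, by omega⟩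
  · rintro ⟨j, ⟨hj, rfl, rfl⟩, rfl⟩
    exact h.isPhase hj

theorem phaseCount_eq_card (m : Fin 2) (d : Fin Δ) :
    phaseCount s m (d + 1) =
      (Finset.univ.filter fun j : Fin t => (j : ℕ) < n ∧ phaseState j = m ∧ D j = d).card := by
  classical
  have hinj : Function.Injective fun j : Fin t => switchTime D j := fun i j hij =>
    Fin.ext ((strictMonoOn_switchTime D).injOn i.2.le j.2.le hij)
  rw [phaseCount, ← Finset.card_image_of_injective _ hinj]
  congr 1
  ext a
  simp only [Finset.mem_filter, Finset.mem_range, Finset.mem_image, Finset.mem_univ,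
    true_and, h.isPhase_iff, and_iff_right_iff_imp]
  rintro ⟨j, ⟨hj, -⟩, rfl⟩
  exact (strictMonoOn_switchTime D j.2.le h.le hj).trans_eq h.switchTime_eq

@[to_additive]
theorem prod_phaseCount {M : Type*} [CommMonoid M] (f : Fin 2 → Fin Δ → M) :
    ∏ m, ∏ d, f m d ^ phaseCount s m (d + 1) =
      ∏ j ∈ {j : Fin t | (j : ℕ) < n}, f (phaseState j) (D j) := by
  classical
  rw [← Finset.prod_fiberwise _ (fun j : Fin t => phaseState j)]
  refine Finset.prod_congr rfl fun m _ => ?_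
  rw [← Finset.prod_fiberwise _ D]
  refine Finset.prod_congr rfl fun d _ => ?_
  rw [h.phaseCount_eq_card, Finset.filter_filter, Finset.filter_filter, ← Finset.prod_const]
  refine Finset.prod_congr rfl fun j hj => ?_
  obtain ⟨-, -, rfl, rfl⟩ := Finset.mem_filter.1 hj
  rfl

theorem card_state_eq (m : Fin 2) :
    (Finset.univ.filter fun k => s k = m).card =
      ∑ j ∈ {j : Fin t | (j : ℕ) < n}, if phaseState j = m then (D j : ℕ) + 1 else 0 := by
  classical
  choose i hi hi' using exists_switchTime_le_lt D
  rw [← Finset.sum_filter, Finset.filter_filter, Finset.card_eq_sum_card_fiberwise (f := i)]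
  · refine Finset.sum_congr rfl fun j hj => ?_
    obtain ⟨-, hjn, hjm⟩ := Finset.mem_filter.1 hj
    have hle : switchTime D (j + 1) ≤ t :=
      (monotone_switchTime D hjn).trans_eq h.switchTime_eq
    have hfiber : ((Finset.univ.filter fun k => s k = m).filter fun k => i k = j).map
        Fin.valEmbedding = Finset.Ico (switchTime D j) (switchTime D (j + 1)) := by
      ext k
      simp only [Finset.mem_map, Finset.mem_filter, Finset.mem_univ, true_and,
        Fin.valEmbedding_apply, Finset.mem_Ico]
      constructor
      · rintro ⟨k, ⟨-, rfl⟩, rfl⟩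
        exact ⟨hi k, hi' k⟩
      · rintro ⟨hk, hk'⟩
        exact ⟨⟨k, hk'.trans_le hle⟩, ⟨(h.generates j _ hk hk').trans hjm,
          Fin.ext (eq_of_switchTime_le_lt (hi _) (hi' _) hk hk')⟩, rfl⟩
    rw [← Finset.card_map, hfiber, Nat.card_Ico, switchTime_succ]
    omega
  · intro k hk
    simp only [Finset.coe_filter, Finset.mem_univ, true_and, Set.mem_ofPred_eq] at hk ⊢
    exact ⟨h.lt_of_switchTime_le k (hi k), (h.generates _ k (hi k) (hi' k)).symm.trans hk⟩

theorem generates_of_eqOn (hD : ∀ j : Fin t, (j : ℕ) < n → D' j = D j) : Generates D' s := by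
  have hcongr {i : ℕ} (hi : i ≤ n) : switchTime D' i = switchTime D i :=
    switchTime_congr fun j hj => hD j (hj.trans_le hi)
  intro i k hi hi'
  have hin : (i : ℕ) < n := (monotone_switchTime D').reflect_lt
    (hi.trans_lt (k.2.trans_eq (h.switchTime_eq.symm.trans (hcongr le_rfl).symm)))
  exact h.generates i k (hcongr hin.le ▸ hi) (hcongr hin ▸ hi')

theorem eq_of_generates (hD : Generates D' s) {j : Fin t} (hj : (j : ℕ) + 1 < n) :
    D' j = D j := by
  have hswitch (i : ℕ) (hi : i < n) : switchTime D' i = switchTime D i := by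
    induction i with
    | zero => rw [switchTime_zero, switchTime_zero]
    | succ i ih =>
      have hlt : switchTime D (i + 1) < t :=
        (strictMonoOn_switchTime D (hi.le.trans h.le) h.le hi).trans_eq h.switchTime_eq
      have hle := h.generates.switchTime_succ_le hD (ih (by omega)).symm hlt
      exact hle.antisymm (hD.switchTime_succ_le h.generates (ih (by omega)) (hle.trans_lt hlt))
  have h₁ := hswitch (j + 1) hj
  rw [switchTime_succ, switchTime_succ, hswitch j (by omega)] at h₁
  exact Fin.ext (by omega)

end IsPhaseDecomposition

theorem mem_feasible_iff {p : Fin 2 → Fin Δ → ℝ} (hp : ∀ m d, 0 < p m d) :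
    s ∈ feasible p t ↔ ∃ D : Fin t → Fin Δ, Generates D s := by
  classical
  have hprod (D : Fin t → Fin Δ) : 0 < ∏ i : Fin t, p (phaseState i) (D i) :=
    Finset.prod_pos fun i _ => hp _ _
  rw [feasible, Finset.mem_filter, seqProb, Finset.sum_pos_iff_of_nonneg fun D _ => (hprod D).le]
  simp [hprod]

end Phases

section Weights

theorem sum_prod_filter_eqOn {ι α R : Type*} [Fintype ι] [DecidableEq ι] [Fintype α]
    [DecidableEq α] [CommSemiring R] {w : ι → α → R} (hw : ∀ i, ∑ a, w i a = 1)
    (S : Finset ι) (f₀ : ι → α) :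
    ∑ f ∈ {f : ι → α | ∀ i ∈ S, f i = f₀ i}, ∏ i, w i (f i) = ∏ i ∈ S, w i (f₀ i) := by
  have hpi : (Finset.univ.filter fun f => ∀ i ∈ S, f i = f₀ i) =
      Fintype.piFinset fun i => if i ∈ S then {f₀ i} else Finset.univ := by
    ext f
    simp only [Finset.mem_filter, Finset.mem_univ, true_and, Fintype.mem_piFinset]
    refine forall_congr' fun i => ?_
    split_ifs with hi <;> simp [hi]
  rw [hpi, ← Finset.prod_univ_sum, ← Finset.prod_subset (Finset.subset_univ S)]
  · exact Finset.prod_congr rfl fun i hi => by rw [if_pos hi, Finset.sum_singleton]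
  · exact fun i _ hi => by rw [if_neg hi, hw]

variable {Δ t : ℕ} {π p : Fin 2 → Fin Δ → ℝ} {s : Fin t → Fin 2}

/-- The product of the weights `π m d` of all phases of `s`. This is the probability under `π` of
`s` together with the event that a phase ends at time `t`; unlike `seqProb` it is a function of the
type of `s` alone. -/
def seqWeight (π : Fin 2 → Fin Δ → ℝ) (s : Fin t → Fin 2) : ℝ :=
  ∏ m, ∏ d, π m d ^ phaseCount s m ((d : ℕ) + 1)

theorem seqWeight_le_seqProb (hπ : ∀ m d, 0 ≤ π m d) (hsum : ∀ m, ∑ d, π m d = 1)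
    (hs : s ∈ feasible p t) : seqWeight π s ≤ seqProb π s := by
  classical
  obtain ⟨D, n, h⟩ := exists_isPhaseDecomposition_of_mem_feasible hs
  rw [seqWeight, h.prod_phaseCount,
    ← sum_prod_filter_eqOn (w := fun i : Fin t => π (phaseState i)) fun i => hsum _, seqProb]
  refine Finset.sum_le_sum_of_subset_of_nonneg (fun D' hD => ?_)
    fun D' _ _ => Finset.prod_nonneg fun i _ => hπ _ _
  simp only [Finset.mem_filter, Finset.mem_univ, true_and] at hD ⊢
  exact h.generates_of_eqOn hD

-- `s` determines all its phase durations except for the last one, whose weight is at least `κ`.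
theorem mul_seqProb_le_seqWeight {κ : ℝ} (hκ₀ : 0 ≤ κ) (hκ₁ : κ ≤ 1) (hκ : ∀ m d, κ ≤ π m d)
    (hsum : ∀ m, ∑ d, π m d = 1) (hs : s ∈ feasible p t) :
    κ * seqProb π s ≤ seqWeight π s := by
  classical
  have hπ m d : 0 ≤ π m d := hκ₀.trans (hκ m d)
  obtain ⟨D, n, h⟩ := exists_isPhaseDecomposition_of_mem_feasible hs
  have hprob : seqProb π s ≤ ∏ j ∈ {j : Fin t | (j : ℕ) + 1 < n}, π (phaseState j) (D j) := by
    rw [← sum_prod_filter_eqOn (w := fun i : Fin t => π (phaseState i)) fun i => hsum _, seqProb]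
    refine Finset.sum_le_sum_of_subset_of_nonneg (fun D' hD' => ?_)
      fun D' _ _ => Finset.prod_nonneg fun i _ => hπ _ _
    simp only [Finset.mem_filter, Finset.mem_univ, true_and] at hD' ⊢
    exact fun j hj => h.eq_of_generates hD' hj
  refine (mul_le_mul_of_nonneg_left hprob hκ₀).trans ?_
  rw [seqWeight, h.prod_phaseCount]
  rcases n with _ | n
  · simpa using hκ₁
  · have hfilter : (Finset.univ.filter fun j : Fin t => (j : ℕ) < n + 1) =
        insert ⟨n, h.le⟩ (Finset.univ.filter fun j : Fin t => (j : ℕ) + 1 < n + 1) := by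
      ext j
      simp only [Finset.mem_filter, Finset.mem_univ, true_and, Finset.mem_insert, Fin.ext_iff]
      omega
    rw [hfilter, Finset.prod_insert (by simp)]
    exact mul_le_mul_of_nonneg_right (hκ _ _) (Finset.prod_nonneg fun j _ => hπ _ _)

theorem sum_feasible_seqProb (hp : ∀ m d, 0 < p m d) (hsum : ∀ m, ∑ d, π m d = 1) :
    ∑ s ∈ feasible p t, seqProb π s = 1 := by
  classical
  have hunique (D : Fin t → Fin Δ) :
      ∃ s₀ ∈ feasible p t, ∀ s, Generates D s ↔ s = s₀ := by
    obtain ⟨s₀, h₀, huniq⟩ := existsUnique_generates D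
    exact ⟨s₀, (mem_feasible_iff hp).2 ⟨D, h₀⟩, fun s => ⟨huniq s, by rintro rfl; exact h₀⟩⟩
  simp only [seqProb, Finset.sum_filter]
  rw [Finset.sum_comm]
  calc ∑ D : Fin t → Fin Δ, ∑ s ∈ feasible p t,
        (if Generates D s then ∏ i : Fin t, π (phaseState i) (D i) else 0)
      = ∑ D : Fin t → Fin Δ, ∏ i : Fin t, π (phaseState i) (D i) := by
        refine Finset.sum_congr rfl fun D _ => ?_
        obtain ⟨s₀, hs₀, h⟩ := hunique D
        simp [h, hs₀]
    _ = 1 := by simp [← Fintype.prod_sum fun (i : Fin t) d => π (phaseState i) d, hsum]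

theorem sum_feasible_seqWeight_le_one (hp : ∀ m d, 0 < p m d) (hπ : ∀ m d, 0 ≤ π m d)
    (hsum : ∀ m, ∑ d, π m d = 1) : ∑ s ∈ feasible p t, seqWeight π s ≤ 1 :=
  (Finset.sum_le_sum fun _ hs => seqWeight_le_seqProb hπ hsum hs).trans_eq
    (sum_feasible_seqProb hp hsum)

theorem exists_le_sum_feasible_seqWeight (hp : ∀ m d, 0 < p m d) (hπ : ∀ m d, 0 < π m d)
    (hsum : ∀ m, ∑ d, π m d = 1) :
    ∃ κ : ℝ, 0 < κ ∧ ∀ t, κ ≤ ∑ s ∈ feasible p t, seqWeight π s := by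
  have hne : Nonempty (Fin Δ) := by
    by_contra! hempty
    simpa using hsum 0
  obtain ⟨⟨m, d⟩, hmin⟩ := Finite.exists_min fun x : Fin 2 × Fin Δ => π x.1 x.2
  have hle : π m d ≤ 1 :=
    (Finset.single_le_sum (fun e _ => (hπ m e).le) (Finset.mem_univ d)).trans_eq (hsum m)
  refine ⟨π m d, hπ m d, fun t => ?_⟩
  calc π m d = ∑ s ∈ feasible p t, π m d * seqProb π s := by
        rw [← Finset.mul_sum, sum_feasible_seqProb hp hsum, mul_one]
    _ ≤ _ := Finset.sum_le_sum fun s hs =>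
        mul_seqProb_le_seqWeight (hπ m d).le hle (fun m d => hmin (m, d)) hsum hs

end Weights

section Types

variable {Δ t : ℕ} {p : Fin 2 → Fin Δ → ℝ} {s : Fin t → Fin 2}

theorem qDot_seqType (hs : s ∈ feasible p t) (m : Fin 2) :
    qDot (seqType Δ s m) = ((Finset.univ.filter fun k => s k = m).card : ℝ) / t := by
  obtain ⟨D, n, h⟩ := exists_isPhaseDecomposition_of_mem_feasible hs
  have hsum := h.sum_phaseCount fun m' d => if m' = m then (d : ℕ) + 1 else 0
  rw [h.card_state_eq, ← hsum]
  simp [qDot, seqType, Finset.sum_div, mul_div_assoc, mul_comm]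

theorem fracState2_eq_qDot (hs : s ∈ feasible p t) : fracState2 s = qDot (seqType Δ s 1) :=
  (qDot_seqType hs 1).symm

theorem qDot_seqType_add (ht : 1 ≤ t) (hs : s ∈ feasible p t) :
    qDot (seqType Δ s 0) + qDot (seqType Δ s 1) = 1 := by
  have hcompl : (Finset.univ.filter fun k => s k = 1) = Finset.univ.filter fun k => ¬s k = 0 :=
    Finset.filter_congr fun k _ => by omega
  rw [qDot_seqType hs, qDot_seqType hs, ← add_div, ← Nat.cast_add, hcompl,
    Finset.card_filter_add_card_filter_not, Finset.card_univ, Fintype.card_fin]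
  exact div_self (by positivity)

theorem sum_phaseState_sign (n : ℕ) :
    (∑ i ∈ Finset.range n, if phaseState i = 0 then (1 : ℝ) else -1) = if Even n then 0 else 1 := by
  induction n with
  | zero => simp
  | succ n ih =>
    rw [Finset.sum_range_succ, ih]
    by_cases h : Even n <;> simp [Nat.even_add_one, h, phaseState]

theorem abs_sum_seqType_sub_le (hs : s ∈ feasible p t) :
    |∑ d, seqType Δ s 0 d - ∑ d, seqType Δ s 1 d| ≤ 1 / t := by
  obtain ⟨D, n, h⟩ := exists_isPhaseDecomposition_of_mem_feasible hs
  have hrange : (Finset.univ.filter fun j : Fin t => (j : ℕ) < n).map Fin.valEmbedding =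
      Finset.range n := by
    ext j
    simp only [Finset.mem_map, Finset.mem_filter, Finset.mem_univ, true_and,
      Fin.valEmbedding_apply, Finset.mem_range]
    exact ⟨by rintro ⟨j, hj, rfl⟩; exact hj, fun hj => ⟨⟨j, hj.trans_le h.le⟩, hj, rfl⟩⟩
  have hsign := h.sum_phaseCount fun m _ => if m = 0 then (1 : ℝ) else -1
  have hdiff : ∑ d, seqType Δ s 0 d - ∑ d, seqType Δ s 1 d =
      (if Even n then 0 else 1 : ℝ) / t := by
    rw [← sum_phaseState_sign, ← hrange, Finset.sum_map]
    simp only [Fin.valEmbedding_apply]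
    rw [← hsign]
    simp [seqType, Finset.sum_div, sub_eq_add_neg, add_div, neg_div]
  rw [hdiff, abs_div, Nat.abs_cast]
  gcongr
  split_ifs <;> simp

theorem seqType_nonneg (s : Fin t → Fin 2) (m : Fin 2) (d : Fin Δ) : 0 ≤ seqType Δ s m d := by
  unfold seqType; positivity

theorem seqType_le_one (s : Fin t → Fin 2) (m : Fin 2) (d : Fin Δ) : seqType Δ s m d ≤ 1 := by
  refine div_le_one_of_le₀ (Nat.cast_le.2 ?_) t.cast_nonneg
  classical
  exact (Finset.card_filter_le _ _).trans (Finset.card_range t).le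

end Types

section Entropy

open InformationTheory

variable {Δ : ℕ} {l : Fin Δ → ℝ} {ν π : Fin 2 → Fin Δ → ℝ}

theorem continuous_qDot : Continuous (qDot : (Fin Δ → ℝ) → ℝ) := by
  unfold qDot; fun_prop

theorem sum_le_qDot (hl : ∀ d, 0 ≤ l d) : ∑ d, l d ≤ qDot l :=
  Finset.sum_le_sum fun d _ => le_mul_of_one_le_left (hl d) (by simp)

theorem qDot_le_mul_sum (hl : ∀ d, 0 ≤ l d) : qDot l ≤ Δ * ∑ d, l d := by
  rw [Finset.mul_sum]
  refine Finset.sum_le_sum fun d _ => mul_le_mul_of_nonneg_right ?_ (hl d)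
  exact_mod_cast d.2

theorem sum_pos_of_mem_typeSet (hν : ν ∈ typeSet Δ) (m : Fin 2) : 0 < ∑ d, ν m d := by
  obtain ⟨hnn, hbal, hone⟩ := hν
  have key : 0 < ∑ d, ν 0 d := by
    refine (Finset.sum_nonneg fun d _ => hnn 0 d).lt_of_ne' fun hzero => ?_
    have h₀ := qDot_le_mul_sum (hnn 0)
    have h₁ := qDot_le_mul_sum (hnn 1)
    rw [← hbal, hzero] at h₁
    rw [hzero] at h₀
    linarith
  fin_cases m
  exacts [key, hbal ▸ key]

theorem qDot_pos_of_mem_typeSet (hν : ν ∈ typeSet Δ) (m : Fin 2) : 0 < qDot (ν m) :=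
  (sum_pos_of_mem_typeSet hν m).trans_le (sum_le_qDot (hν.1 m))

/-- The types that satisfy the balance condition of `typeSet` up to an error `ε`: a sequence of
length `t` has at most one more phase of state 1 than of state 2, so its type has `ε = 1 / t`. -/
def relaxedTypeSet (Δ : ℕ) (ε : ℝ) : Set (Fin 2 → Fin Δ → ℝ) :=
  {ν | (∀ m d, 0 ≤ ν m d) ∧ |∑ d, ν 0 d - ∑ d, ν 1 d| ≤ ε ∧ qDot (ν 0) + qDot (ν 1) = 1}

theorem relaxedTypeSet_zero : relaxedTypeSet Δ 0 = typeSet Δ := by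
  simp only [relaxedTypeSet, typeSet, abs_nonpos_iff, sub_eq_zero]

theorem isClosed_relaxedTypeSet (Δ : ℕ) (ε : ℝ) : IsClosed (relaxedTypeSet Δ ε) := by
  simp only [relaxedTypeSet, Set.ofPred_and, Set.ofPred_forall]
  refine (isClosed_iInter fun m => isClosed_iInter fun d => ?_).inter (IsClosed.inter ?_ ?_)
  · exact isClosed_le continuous_const (by fun_prop)
  · exact isClosed_le (by fun_prop) continuous_const
  · exact isClosed_eq ((continuous_qDot.comp (continuous_apply 0)).add
      (continuous_qDot.comp (continuous_apply 1))) continuous_const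

theorem isClosed_typeSet (Δ : ℕ) : IsClosed (typeSet Δ) :=
  relaxedTypeSet_zero ▸ isClosed_relaxedTypeSet Δ 0

theorem convex_typeSet (Δ : ℕ) : Convex ℝ (typeSet Δ) := by
  rintro ν ⟨hnn, hbal, hone⟩ ν' ⟨hnn', hbal', hone'⟩ a b ha hb hab
  refine ⟨fun m d => add_nonneg (mul_nonneg ha (hnn m d)) (mul_nonneg hb (hnn' m d)), ?_, ?_⟩
  · simp only [Pi.add_apply, Pi.smul_apply, smul_eq_mul, Finset.sum_add_distrib, ← Finset.mul_sum,
      hbal, hbal']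
  · have hlin (m : Fin 2) : qDot ((a • ν + b • ν') m) = a * qDot (ν m) + b * qDot (ν' m) := by
      simp only [qDot, Finset.mul_sum, ← Finset.sum_add_distrib, Pi.add_apply, Pi.smul_apply,
        smul_eq_mul]
      exact Finset.sum_congr rfl fun d _ => by ring
    rw [hlin, hlin]
    linear_combination a * hone + b * hone' + hab

theorem mem_closure_pos_typeSet (hν : ν ∈ typeSet Δ) :
    ν ∈ closure {V | V ∈ typeSet Δ ∧ ∀ m d, 0 < V m d} := by
  have hnn (d : Fin Δ) : 0 ≤ (fun _ => 1 : Fin Δ → ℝ) d := zero_le_one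
  have hq : 0 < qDot (fun _ : Fin Δ => (1 : ℝ)) := by
    refine lt_of_lt_of_le ?_ (sum_le_qDot hnn)
    by_contra! hle
    have : IsEmpty (Fin Δ) := Fintype.card_eq_zero_iff.1 (by simpa using hle)
    simpa using sum_pos_of_mem_typeSet hν 0
  let c := (2 * qDot fun _ : Fin Δ => (1 : ℝ))⁻¹
  have hc : 0 < c := by positivity
  have hmem : (fun _ _ => c) ∈ typeSet Δ := by
    refine ⟨fun _ _ => hc.le, rfl, ?_⟩
    have hqc : qDot (fun _ : Fin Δ => c) = qDot (fun _ : Fin Δ => (1 : ℝ)) * c := by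
      simp [qDot, Finset.sum_mul]
    rw [hqc]
    simp only [c]
    field_simp
    norm_num
  refine closure_mono ?_ (segment_subset_closure_openSegment
    (left_mem_segment ℝ ν fun _ _ => c))
  rintro _ ⟨a, b, ha, hb, hab, rfl⟩
  exact ⟨convex_typeSet Δ hν hmem ha.le hb.le hab, fun m d =>
    add_pos_of_nonneg_of_pos (mul_nonneg ha.le (hν.1 m d)) (mul_pos hb hc)⟩

/-- The exponential growth rate of the number of sequences of type `ν`. -/
def totalEntropy (ν : Fin 2 → Fin Δ → ℝ) : ℝ := entropy (ν 0) + entropy (ν 1)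

theorem entropy_eq_sum_negMulLog (hl : ∀ d, 0 ≤ l d) :
    entropy l = ∑ d, Real.negMulLog (l d) - Real.negMulLog (∑ d, l d) := by
  rw [entropy, Real.negMulLog_eq_neg, sub_neg_eq_add, Finset.sum_mul,
    ← Finset.sum_add_distrib, ← Finset.sum_neg_distrib]
  refine Finset.sum_congr rfl fun d _ => ?_
  rcases (hl d).eq_or_lt with h | h
  · simp [← h]
  · have hS : 0 < ∑ e, l e :=
      h.trans_le (Finset.single_le_sum (fun e _ => hl e) (Finset.mem_univ d))
    rw [Real.log_div h.ne' hS.ne']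
    ring

theorem continuousOn_totalEntropy (Δ : ℕ) : ContinuousOn (totalEntropy (Δ := Δ)) (typeSet Δ) := by
  have h : Continuous fun ν : Fin 2 → Fin Δ → ℝ =>
      (∑ d, Real.negMulLog (ν 0 d) - Real.negMulLog (∑ d, ν 0 d)) +
        (∑ d, Real.negMulLog (ν 1 d) - Real.negMulLog (∑ d, ν 1 d)) := by
    fun_prop
  refine h.continuousOn.congr fun ν hν => ?_
  rw [totalEntropy, entropy_eq_sum_negMulLog (hν.1 0), entropy_eq_sum_negMulLog (hν.1 1)]

/-- The duration laws of the phases of a sequence of type `ν`. -/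
def phaseLaw (ν : Fin 2 → Fin Δ → ℝ) (m : Fin 2) (d : Fin Δ) : ℝ := ν m d / ∑ e, ν m e

theorem sum_phaseLaw (hν : ν ∈ typeSet Δ) (m : Fin 2) : ∑ d, phaseLaw ν m d = 1 := by
  simp only [phaseLaw, ← Finset.sum_div]
  exact div_self (sum_pos_of_mem_typeSet hν m).ne'

theorem phaseLaw_pos (hν : ν ∈ typeSet Δ) (hpos : ∀ m d, 0 < ν m d) (m : Fin 2) (d : Fin Δ) :
    0 < phaseLaw ν m d :=
  div_pos (hpos m d) (sum_pos_of_mem_typeSet hν m)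

theorem injOn_phaseLaw : Set.InjOn (phaseLaw (Δ := Δ)) (typeSet Δ) := by
  have hmul {ν : Fin 2 → Fin Δ → ℝ} (hν : ν ∈ typeSet Δ) (m d) :
      ν m d = (∑ e, ν 0 e) * phaseLaw ν m d := by
    have hbal : ∑ e, ν m e = ∑ e, ν 0 e := by
      fin_cases m
      exacts [rfl, hν.2.1.symm]
    rw [phaseLaw, hbal, mul_div_cancel₀ _ (sum_pos_of_mem_typeSet hν 0).ne']
  have hscale {ν : Fin 2 → Fin Δ → ℝ} (hν : ν ∈ typeSet Δ) :
      (∑ e, ν 0 e) * (qDot (phaseLaw ν 0) + qDot (phaseLaw ν 1)) = 1 := by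
    have hqDot (m : Fin 2) : qDot (ν m) = (∑ e, ν 0 e) * qDot (phaseLaw ν m) := by
      rw [qDot, qDot, Finset.mul_sum]
      refine Finset.sum_congr rfl fun d _ => ?_
      rw [hmul hν m d, mul_left_comm]
    rw [mul_add, ← hqDot, ← hqDot, hν.2.2]
  intro ν hν ν' hν' h
  have hS : ∑ e, ν 0 e = ∑ e, ν' 0 e := by
    rw [eq_inv_of_mul_eq_one_left (hscale hν), eq_inv_of_mul_eq_one_left (hscale hν'), h]
  ext m d
  rw [hmul hν, hmul hν', hS, h]

/-- The cross entropy of the type `ν` relative to the duration weights `π`: a sequence of length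
`t` and type `ν` has weight `exp (-(t * crossEntropy ν π))`. -/
def crossEntropy (ν π : Fin 2 → Fin Δ → ℝ) : ℝ := -∑ m, ∑ d, ν m d * Real.log (π m d)

theorem continuous_crossEntropy (π : Fin 2 → Fin Δ → ℝ) : Continuous (crossEntropy · π) := by
  unfold crossEntropy; fun_prop

theorem crossEntropy_phaseLaw (ν : Fin 2 → Fin Δ → ℝ) :
    crossEntropy ν (phaseLaw ν) = totalEntropy ν := by
  rw [crossEntropy, Fin.sum_univ_two, neg_add]
  rfl

theorem continuousAt_crossEntropy_phaseLaw (hν : ν ∈ typeSet Δ) :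
    ContinuousAt (fun V => crossEntropy ν (phaseLaw V)) ν := by
  refine (tendsto_finsetSum _ fun m _ => tendsto_finsetSum _ fun d _ => ?_).neg
  rcases (hν.1 m d).eq_or_lt with h | h
  · simp only [← h, zero_mul]
    exact tendsto_const_nhds
  · have hS := (sum_pos_of_mem_typeSet hν m).ne'
    have hlaw : ContinuousAt (fun V : Fin 2 → Fin Δ → ℝ => phaseLaw V m d) ν := by
      unfold phaseLaw
      fun_prop (disch := exact hS)
    exact (hlaw.log (div_ne_zero h.ne' hS)).const_mul _

theorem crossEntropy_sub_totalEntropy (hν : ν ∈ typeSet Δ) (hπ : ∀ m d, 0 < π m d)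
    (hsum : ∀ m, ∑ d, π m d = 1) :
    crossEntropy ν π - totalEntropy ν =
      ∑ m, ∑ d, (∑ e, ν m e) * π m d * klFun (phaseLaw ν m d / π m d) := by
  have hterm (m d) : (∑ e, ν m e) * π m d * klFun (phaseLaw ν m d / π m d) =
      ν m d * Real.log (phaseLaw ν m d) - ν m d * Real.log (π m d) +
        ((∑ e, ν m e) * π m d - ν m d) := by
    have hS := sum_pos_of_mem_typeSet hν m
    have hνm : ν m d = (∑ e, ν m e) * phaseLaw ν m d := (mul_div_cancel₀ _ hS.ne').symm
    rcases (hν.1 m d).eq_or_lt with h | h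
    · simp [phaseLaw, ← h, klFun_zero]
    · have hlaw : phaseLaw ν m d ≠ 0 := (div_pos h hS).ne'
      have hπm := (hπ m d).ne'
      rw [klFun_apply, Real.log_div hlaw hπm, hνm]
      field_simp
      ring
  simp only [hterm, Finset.sum_add_distrib, Finset.sum_sub_distrib, ← Finset.mul_sum, hsum, mul_one,
    sub_self, add_zero]
  rw [← crossEntropy_phaseLaw, crossEntropy, crossEntropy]
  ring

theorem totalEntropy_lt_crossEntropy (hν : ν ∈ typeSet Δ) (hπ : ∀ m d, 0 < π m d)
    (hsum : ∀ m, ∑ d, π m d = 1) (hne : phaseLaw ν ≠ π) : totalEntropy ν < crossEntropy ν π := by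
  obtain ⟨m, d, hmd⟩ : ∃ m d, phaseLaw ν m d ≠ π m d := by
    by_contra! h
    exact hne (funext₂ h)
  have hratio (m d) : 0 ≤ phaseLaw ν m d / π m d :=
    div_nonneg (div_nonneg (hν.1 m d) (sum_pos_of_mem_typeSet hν m).le) (hπ m d).le
  have hcoef (m d) : 0 < (∑ e, ν m e) * π m d := mul_pos (sum_pos_of_mem_typeSet hν m) (hπ m d)
  have hterm (m d) := mul_nonneg (hcoef m d).le (klFun_nonneg (hratio m d))
  rw [← sub_pos, crossEntropy_sub_totalEntropy hν hπ hsum]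
  refine Finset.sum_pos' (fun m _ => Finset.sum_nonneg fun d _ => hterm m d) ⟨m, Finset.mem_univ m,
    Finset.sum_pos' (fun d _ => hterm m d) ⟨d, Finset.mem_univ d, mul_pos (hcoef m d) ?_⟩⟩
  refine (klFun_nonneg (hratio m d)).lt_of_ne' fun hzero => hmd ?_
  exact (div_eq_one_iff_eq (hπ m d).ne').1 ((klFun_eq_zero_iff (hratio m d)).1 hzero)

theorem totalEntropy_le_crossEntropy (hν : ν ∈ typeSet Δ) (hπ : ∀ m d, 0 < π m d)
    (hsum : ∀ m, ∑ d, π m d = 1) : totalEntropy ν ≤ crossEntropy ν π := by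
  rcases eq_or_ne (phaseLaw ν) π with rfl | hne
  · exact (crossEntropy_phaseLaw ν).ge
  · exact (totalEntropy_lt_crossEntropy hν hπ hsum hne).le

end Entropy

section TypeClass

variable {Δ t : ℕ} {p ν π : Fin 2 → Fin Δ → ℝ}

theorem tendsto_exp_neg_natCast_mul {c : ℝ} (hc : 0 < c) :
    Tendsto (fun t : ℕ => Real.exp (-(t * c))) atTop (𝓝 0) :=
  Real.tendsto_exp_neg_atTop_nhds_zero.comp (tendsto_natCast_atTop_atTop.atTop_mul_const hc)

theorem seqWeight_pos (hπ : ∀ m d, 0 < π m d) (s : Fin t → Fin 2) : 0 < seqWeight π s :=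
  Finset.prod_pos fun m _ => Finset.prod_pos fun d _ => pow_pos (hπ m d) _

theorem seqWeight_eq_exp (ht : 1 ≤ t) (hπ : ∀ m d, 0 < π m d) (s : Fin t → Fin 2) :
    seqWeight π s = Real.exp (-(t * crossEntropy (seqType Δ s) π)) := by
  have ht' : (t : ℝ) ≠ 0 := by positivity
  have hpow (m : Fin 2) (d : Fin Δ) : π m d ^ phaseCount s m ((d : ℕ) + 1) =
      Real.exp (t * (seqType Δ s m d * Real.log (π m d))) := by
    rw [seqType, ← mul_assoc, mul_div_cancel₀ _ ht', Real.exp_nat_mul, Real.exp_log (hπ m d)]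
  simp only [seqWeight, hpow, ← Real.exp_sum, crossEntropy, ← Finset.mul_sum, mul_neg, neg_neg]

open Classical in
/-- The feasible sequences of length `t` whose type belongs to `U`. -/
def typeClass (p : Fin 2 → Fin Δ → ℝ) (t : ℕ) (U : Set (Fin 2 → Fin Δ → ℝ)) :
    Finset (Fin t → Fin 2) :=
  (feasible p t).filter fun s => seqType Δ s ∈ U

theorem mem_typeClass {U : Set (Fin 2 → Fin Δ → ℝ)} {s : Fin t → Fin 2} :
    s ∈ typeClass p t U ↔ s ∈ feasible p t ∧ seqType Δ s ∈ U := by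
  classical
  rw [typeClass, Finset.mem_filter]

theorem monotone_typeClass (p : Fin 2 → Fin Δ → ℝ) (t : ℕ) : Monotone (typeClass p t) :=
  fun _ _ h _ hs => mem_typeClass.2 ⟨(mem_typeClass.1 hs).1, h (mem_typeClass.1 hs).2⟩

theorem card_typeClass_le_exp (hp : ∀ m d, 0 < p m d) (hπ : ∀ m d, 0 < π m d)
    (hsum : ∀ m, ∑ d, π m d = 1) (ht : 1 ≤ t) {U : Set (Fin 2 → Fin Δ → ℝ)} {c : ℝ}
    (hU : ∀ V ∈ U, crossEntropy V π ≤ c) : ((typeClass p t U).card : ℝ) ≤ Real.exp (t * c) := by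
  have hmass : (typeClass p t U).card • Real.exp (-(t * c)) ≤ 1 := by
    calc (typeClass p t U).card • Real.exp (-(t * c))
        ≤ ∑ s ∈ typeClass p t U, seqWeight π s := by
          refine Finset.card_nsmul_le_sum _ _ _ fun s hs => ?_
          rw [seqWeight_eq_exp ht hπ]
          gcongr
          exact hU _ (mem_typeClass.1 hs).2
      _ ≤ ∑ s ∈ feasible p t, seqWeight π s :=
          Finset.sum_le_sum_of_subset_of_nonneg (fun s hs => (mem_typeClass.1 hs).1)
            fun s _ _ => (seqWeight_pos hπ s).le
      _ ≤ 1 := sum_feasible_seqWeight_le_one hp (fun m d => (hπ m d).le) hsum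
  rwa [nsmul_eq_mul, Real.exp_neg, ← div_eq_mul_inv, div_le_one (Real.exp_pos _)] at hmass

theorem exists_nhds_card_typeClass_le (hp : ∀ m d, 0 < p m d) (hν : ν ∈ typeSet Δ) {ε : ℝ}
    (hε : 0 < ε) :
    ∃ U ∈ 𝓝 ν, ∀ t, 1 ≤ t →
      ((typeClass p t U).card : ℝ) ≤ Real.exp (t * (totalEntropy ν + ε)) := by
  have hclose : ∀ᶠ V in 𝓝 ν, crossEntropy ν (phaseLaw V) < totalEntropy ν + ε :=
    (continuousAt_crossEntropy_phaseLaw hν).eventually_lt_const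
      (by simpa only [crossEntropy_phaseLaw] using lt_add_of_pos_right _ hε)
  obtain ⟨V, ⟨hV, hpos⟩, hlt⟩ :=
    ((mem_closure_iff_frequently.1 (mem_closure_pos_typeSet hν)).and_eventually hclose).exists
  exact ⟨{W | crossEntropy W (phaseLaw V) < totalEntropy ν + ε},
    (continuous_crossEntropy _).continuousAt.eventually_lt_const hlt,
    fun t ht => card_typeClass_le_exp hp (phaseLaw_pos hV hpos) (sum_phaseLaw hV) ht
      fun _ hW => le_of_lt hW⟩

theorem exists_nhds_typeClass_eq_empty (p : Fin 2 → Fin Δ → ℝ) (hν : ν ∉ typeSet Δ) :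
    ∃ U ∈ 𝓝 ν, ∀ᶠ t : ℕ in atTop, typeClass p t U = ∅ := by
  obtain ⟨ε, hε, hνε⟩ : ∃ ε > 0, ν ∉ relaxedTypeSet Δ ε := by
    by_contra! hall
    refine hν (relaxedTypeSet_zero ▸ ⟨(hall 1 one_pos).1, ?_, (hall 1 one_pos).2.2⟩)
    exact le_of_forall_pos_le_add fun ε hε => by simpa using (hall ε hε).2.1
  refine ⟨_, (isClosed_relaxedTypeSet Δ ε).isOpen_compl.mem_nhds hνε, ?_⟩
  filter_upwards [tendsto_one_div_atTop_nhds_zero_nat.eventually_le_const hε,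
    eventually_ge_atTop 1] with t htε ht
  refine Finset.eq_empty_of_forall_notMem fun s hs => ?_
  obtain ⟨hs, hsε⟩ := mem_typeClass.1 hs
  exact hsε ⟨seqType_nonneg s, (abs_sum_seqType_sub_le hs).trans htε, qDot_seqType_add ht hs⟩

theorem exists_nhds_tendsto_sum_seqWeight (hp : ∀ m d, 0 < p m d) (hπ : ∀ m d, 0 < π m d)
    (hν : ν ∈ typeSet Δ → totalEntropy ν < crossEntropy ν π) :
    ∃ U ∈ 𝓝 ν, Tendsto (fun t => ∑ s ∈ typeClass p t U, seqWeight π s) atTop (𝓝 0) := by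
  by_cases hmem : ν ∈ typeSet Δ
  swap
  · obtain ⟨U, hU, hempty⟩ := exists_nhds_typeClass_eq_empty p hmem
    exact ⟨U, hU, tendsto_const_nhds.congr' (hempty.mono fun t ht => by
      simp only [ht, Finset.sum_empty])⟩
  obtain ⟨c, hc₁, hc₂⟩ := exists_between (hν hmem)
  obtain ⟨b, hb₁, hb₂⟩ := exists_between hc₁
  obtain ⟨U, hU, hcard⟩ := exists_nhds_card_typeClass_le hp hmem (sub_pos.2 hb₁)
  rw [add_sub_cancel] at hcard
  refine ⟨U ∩ {V | c < crossEntropy V π}, inter_mem hU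
    ((continuous_crossEntropy π).continuousAt.eventually_const_lt hc₂),
    squeeze_zero' (Eventually.of_forall fun t => Finset.sum_nonneg fun s _ =>
      (seqWeight_pos hπ s).le) ?_ (tendsto_exp_neg_natCast_mul (sub_pos.2 hb₂))⟩
  filter_upwards [eventually_ge_atTop 1] with t ht
  calc ∑ s ∈ typeClass p t (U ∩ {V | c < crossEntropy V π}), seqWeight π s
      ≤ (typeClass p t (U ∩ {V | c < crossEntropy V π})).card • Real.exp (-(t * c)) := by
        refine Finset.sum_le_card_nsmul _ _ _ fun s hs => ?_
        rw [seqWeight_eq_exp ht hπ]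
        gcongr
        exact le_of_lt (mem_typeClass.1 hs).2.2
    _ ≤ Real.exp (t * b) * Real.exp (-(t * c)) := by
        rw [nsmul_eq_mul]
        gcongr
        refine le_trans ?_ (hcard t ht)
        exact_mod_cast Finset.card_le_card (monotone_typeClass p t Set.inter_subset_left)
    _ = Real.exp (-(t * (c - b))) := by
        rw [← Real.exp_add]
        ring_nf

theorem sum_seqWeight_typeClass_union_le (hπ : ∀ m d, 0 < π m d) (U V : Set (Fin 2 → Fin Δ → ℝ)) :
    ∑ s ∈ typeClass p t (U ∪ V), seqWeight π s ≤
      ∑ s ∈ typeClass p t U, seqWeight π s + ∑ s ∈ typeClass p t V, seqWeight π s := by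
  classical
  have hunion : typeClass p t (U ∪ V) = typeClass p t U ∪ typeClass p t V := by
    ext s
    simp only [mem_typeClass, Finset.mem_union, Set.mem_union, and_or_left]
  rw [hunion, ← Finset.sum_union_inter]
  exact le_add_of_nonneg_right (Finset.sum_nonneg fun s _ => (seqWeight_pos hπ s).le)

theorem sum_seqWeight_typeClass_mono (hπ : ∀ m d, 0 < π m d) {U V : Set (Fin 2 → Fin Δ → ℝ)}
    (h : U ⊆ V) :
    ∑ s ∈ typeClass p t U, seqWeight π s ≤ ∑ s ∈ typeClass p t V, seqWeight π s :=
  Finset.sum_le_sum_of_subset_of_nonneg (monotone_typeClass p t h)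
    fun s _ _ => (seqWeight_pos hπ s).le

theorem tendsto_sum_seqWeight_of_isCompact (hp : ∀ m d, 0 < p m d) (hπ : ∀ m d, 0 < π m d)
    {K : Set (Fin 2 → Fin Δ → ℝ)} (hK : IsCompact K)
    (hlt : ∀ V ∈ K, V ∈ typeSet Δ → totalEntropy V < crossEntropy V π) :
    Tendsto (fun t => ∑ s ∈ typeClass p t K, seqWeight π s) atTop (𝓝 0) := by
  have hnn (A : Set (Fin 2 → Fin Δ → ℝ)) (t : ℕ) : 0 ≤ ∑ s ∈ typeClass p t A, seqWeight π s :=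
    Finset.sum_nonneg fun s _ => (seqWeight_pos hπ s).le
  refine hK.induction_on
    (p := fun A => Tendsto (fun t => ∑ s ∈ typeClass p t A, seqWeight π s) atTop (𝓝 0))
    (by simp [typeClass]) (fun A B hAB hB => ?_) (fun A B hA hB => ?_) fun V hV => ?_
  · exact squeeze_zero (hnn A) (fun t => sum_seqWeight_typeClass_mono hπ hAB) hB
  · exact squeeze_zero (hnn _) (fun t => sum_seqWeight_typeClass_union_le hπ A B)
      (by simpa only [add_zero] using hA.add hB)
  · obtain ⟨U, hU, h⟩ := exists_nhds_tendsto_sum_seqWeight hp hπ (hlt V hV)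
    exact ⟨U, mem_nhdsWithin_of_mem_nhds hU, h⟩

-- Under the phase laws of `ν` itself, all types other than `ν` have exponentially small weight.
theorem exists_eventually_le_sum_seqWeight (hp : ∀ m d, 0 < p m d) (hν : ν ∈ typeSet Δ)
    (hpos : ∀ m d, 0 < ν m d) {U : Set (Fin 2 → Fin Δ → ℝ)} (hU : U ∈ 𝓝 ν) :
    ∃ κ > 0, ∀ᶠ t : ℕ in atTop, κ ≤ ∑ s ∈ typeClass p t U, seqWeight (phaseLaw ν) s := by
  have hlaw := phaseLaw_pos hν hpos
  obtain ⟨κ, hκ, hle⟩ := exists_le_sum_feasible_seqWeight hp hlaw (sum_phaseLaw hν)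
  have hlt : ∀ V ∈ Set.Icc 0 1 \ interior U, V ∈ typeSet Δ →
      totalEntropy V < crossEntropy V (phaseLaw ν) := fun V hVU hV =>
    totalEntropy_lt_crossEntropy hV hlaw (sum_phaseLaw hν) fun h => hVU.2 <|
      injOn_phaseLaw hV hν h ▸ mem_interior_iff_mem_nhds.2 hU
  have htendsto := tendsto_sum_seqWeight_of_isCompact hp hlaw
    (isCompact_Icc.diff isOpen_interior) hlt
  refine ⟨κ / 2, half_pos hκ, ?_⟩
  filter_upwards [htendsto.eventually_le_const (half_pos hκ)] with t ht
  have hcover : feasible p t ⊆ typeClass p t (U ∪ Set.Icc 0 1 \ interior U) := fun s hs =>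
    mem_typeClass.2 ⟨hs, or_iff_not_imp_left.2 fun hsU => ⟨⟨seqType_nonneg s, seqType_le_one s⟩,
      fun h => hsU (interior_subset h)⟩⟩
  have hsplit := (Finset.sum_le_sum_of_subset_of_nonneg hcover fun s _ _ =>
    (seqWeight_pos hlaw s).le).trans (sum_seqWeight_typeClass_union_le hlaw _ _)
  linarith [hle t]

theorem eventually_le_card_typeClass_of_pos (hp : ∀ m d, 0 < p m d) (hν : ν ∈ typeSet Δ)
    (hpos : ∀ m d, 0 < ν m d) {U : Set (Fin 2 → Fin Δ → ℝ)} (hU : U ∈ 𝓝 ν) {c : ℝ}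
    (hc : c < totalEntropy ν) :
    ∀ᶠ t : ℕ in atTop, Real.exp (t * c) ≤ (typeClass p t U).card := by
  have hlaw := phaseLaw_pos hν hpos
  obtain ⟨b, hcb, hb⟩ := exists_between hc
  have hnear : ∀ᶠ V in 𝓝 ν, b < crossEntropy V (phaseLaw ν) :=
    (continuous_crossEntropy _).continuousAt.eventually_const_lt
      (by simpa only [crossEntropy_phaseLaw] using hb)
  obtain ⟨κ, hκ, hmass⟩ := exists_eventually_le_sum_seqWeight hp hν hpos (inter_mem hU hnear)
  filter_upwards [hmass, eventually_ge_atTop 1,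
    (tendsto_exp_neg_natCast_mul (sub_pos.2 hcb)).eventually_le_const hκ] with t hmass ht hκt
  have hweight : ∑ s ∈ typeClass p t (U ∩ {V | b < crossEntropy V (phaseLaw ν)}),
      seqWeight (phaseLaw ν) s ≤ (typeClass p t U).card * Real.exp (-(t * b)) := by
    rw [← nsmul_eq_mul]
    refine (Finset.sum_le_card_nsmul _ _ _ fun s hs => ?_).trans (nsmul_le_nsmul_left
      (Real.exp_pos _).le (Finset.card_le_card (monotone_typeClass p t Set.inter_subset_left)))
    rw [seqWeight_eq_exp ht hlaw]
    gcongr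
    exact le_of_lt (mem_typeClass.1 hs).2.2
  refine le_of_mul_le_mul_right ?_ (Real.exp_pos (-(t * b)))
  calc Real.exp (t * c) * Real.exp (-(t * b)) = Real.exp (-(t * (b - c))) := by
        rw [← Real.exp_add]
        ring_nf
    _ ≤ (typeClass p t U).card * Real.exp (-(t * b)) := hκt.trans (hmass.trans hweight)

theorem eventually_le_card_typeClass (hp : ∀ m d, 0 < p m d) (hν : ν ∈ typeSet Δ)
    {U : Set (Fin 2 → Fin Δ → ℝ)} (hU : U ∈ 𝓝 ν) {c : ℝ} (hc : c < totalEntropy ν) :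
    ∀ᶠ t : ℕ in atTop, Real.exp (t * c) ≤ (typeClass p t U).card := by
  have hnear : ∀ᶠ V in 𝓝[typeSet Δ] ν, U ∈ 𝓝 V :=
    nhdsWithin_le_nhds (eventually_mem_nhds_iff.2 hU)
  have hclose : ∀ᶠ V in 𝓝[typeSet Δ] ν, U ∈ 𝓝 V ∧ c < totalEntropy V :=
    hnear.and ((continuousOn_totalEntropy Δ ν hν).eventually_const_lt hc)
  obtain ⟨V, ⟨hV, hpos⟩, hlt⟩ := ((mem_closure_iff_frequently.1
    (mem_closure_pos_typeSet hν)).and_eventually (eventually_nhdsWithin_iff.1 hclose)).exists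
  exact eventually_le_card_typeClass_of_pos hp hV hpos (hlt hV).1 (hlt hV).2

end TypeClass

section Root

variable {Δ t : ℕ} {p ν : Fin 2 → Fin Δ → ℝ} {ψ : ℝ}

/-- The duration laws `ψ⁻¹, …, ψ^(-Δ)`, under which all sequences whose last phase ends at time `t`
have the same weight `ψ^(-t)`. -/
def rootWeight (Δ : ℕ) (ψ : ℝ) : Fin 2 → Fin Δ → ℝ := fun _ d => (ψ ^ ((d : ℕ) + 1))⁻¹

theorem rootWeight_pos (hψ : 0 < ψ) (m : Fin 2) (d : Fin Δ) : 0 < rootWeight Δ ψ m d :=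
  inv_pos.2 (pow_pos hψ _)

theorem sum_rootWeight (hψ : 0 < ψ) (hroot : ψ ^ Δ = ∑ i ∈ Finset.range Δ, ψ ^ i) (m : Fin 2) :
    ∑ d, rootWeight Δ ψ m d = 1 := by
  refine mul_right_cancel₀ (pow_pos hψ Δ).ne' ?_
  calc (∑ d, rootWeight Δ ψ m d) * ψ ^ Δ = ∑ d ∈ Finset.range Δ, (ψ ^ (d + 1))⁻¹ * ψ ^ Δ := by
        rw [← Finset.sum_mul, ← Fin.sum_univ_eq_sum_range fun d => (ψ ^ (d + 1))⁻¹]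
        rfl
    _ = ∑ d ∈ Finset.range Δ, ψ ^ (Δ - 1 - d) := Finset.sum_congr rfl fun d hd => by
        have hd' := Finset.mem_range.1 hd
        rw [← div_eq_inv_mul, div_eq_iff (pow_pos hψ _).ne', ← pow_add]
        congr 1
        omega
    _ = 1 * ψ ^ Δ := by rw [Finset.sum_range_reflect fun i => ψ ^ i, one_mul, hroot]

theorem crossEntropy_rootWeight (ν : Fin 2 → Fin Δ → ℝ) :
    crossEntropy ν (rootWeight Δ ψ) = (qDot (ν 0) + qDot (ν 1)) * Real.log ψ := by
  have hm (m : Fin 2) :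
      ∑ d, ν m d * Real.log (rootWeight Δ ψ m d) = -(qDot (ν m) * Real.log ψ) := by
    rw [qDot, Finset.sum_mul, ← Finset.sum_neg_distrib]
    refine Finset.sum_congr rfl fun d _ => ?_
    rw [rootWeight, Real.log_inv, Real.log_pow]
    push_cast
    ring
  rw [crossEntropy, Fin.sum_univ_two, hm, hm]
  ring

theorem totalEntropy_le_log (hψ : 0 < ψ) (hroot : ψ ^ Δ = ∑ i ∈ Finset.range Δ, ψ ^ i)
    (hν : ν ∈ typeSet Δ) : totalEntropy ν ≤ Real.log ψ := by
  simpa only [crossEntropy_rootWeight, hν.2.2, one_mul] using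
    totalEntropy_le_crossEntropy hν (rootWeight_pos hψ) (sum_rootWeight hψ hroot)

theorem sum_feasible_seqWeight_rootWeight (hψ : 0 < ψ) (ht : 1 ≤ t) :
    ∑ s ∈ feasible p t, seqWeight (rootWeight Δ ψ) s =
      (feasible p t).card / Real.exp (t * Real.log ψ) := by
  rw [div_eq_mul_inv, ← nsmul_eq_mul, ← Real.exp_neg]
  refine Finset.sum_eq_card_nsmul fun s hs => ?_
  rw [seqWeight_eq_exp ht (rootWeight_pos hψ), crossEntropy_rootWeight, qDot_seqType_add ht hs,
    one_mul]

theorem card_feasible_le (hp : ∀ m d, 0 < p m d) (hψ : 0 < ψ)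
    (hroot : ψ ^ Δ = ∑ i ∈ Finset.range Δ, ψ ^ i) (ht : 1 ≤ t) :
    ((feasible p t).card : ℝ) ≤ Real.exp (t * Real.log ψ) := by
  have h := sum_feasible_seqWeight_le_one (t := t) hp (fun m d => (rootWeight_pos hψ m d).le)
    (sum_rootWeight hψ hroot)
  rwa [sum_feasible_seqWeight_rootWeight hψ ht, div_le_one (Real.exp_pos _)] at h

theorem exists_mul_exp_le_card_feasible (hp : ∀ m d, 0 < p m d) (hψ : 0 < ψ)
    (hroot : ψ ^ Δ = ∑ i ∈ Finset.range Δ, ψ ^ i) :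
    ∃ κ > 0, ∀ t : ℕ, 1 ≤ t → κ * Real.exp (t * Real.log ψ) ≤ (feasible p t).card := by
  obtain ⟨κ, hκ, h⟩ :=
    exists_le_sum_feasible_seqWeight hp (rootWeight_pos hψ) (sum_rootWeight hψ hroot)
  refine ⟨κ, hκ, fun t ht => ?_⟩
  have := h t
  rwa [sum_feasible_seqWeight_rootWeight hψ ht, le_div_iff₀ (Real.exp_pos _)] at this

end Root

section LargeDeviations

open ExpGrowth

variable {Ω X : Type*} [MeasurableSpace Ω] {P : Measure Ω}

theorem ae_le_of_forall_gt {f : Ω → EReal} {b : EReal}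
    (h : ∀ a : ℝ, b < a → ∀ᵐ ω ∂P, f ω ≤ a) : ∀ᵐ ω ∂P, f ω ≤ b := by
  have hrat : ∀ᵐ ω ∂P, ∀ a : ℚ, b < (a : ℝ) → f ω ≤ (a : ℝ) :=
    ae_all_iff.2 fun a => eventually_imp_distrib_left.2 (h a)
  filter_upwards [hrat] with ω hω
  refine le_of_forall_gt_imp_ge_of_dense fun c hc => ?_
  obtain ⟨a, hba, hac⟩ := EReal.lt_iff_exists_rat_btwn.1 hc
  exact (hω a hba).trans hac.le

variable [TopologicalSpace X] [MeasurableSpace X] {Q : ℕ → Ω → Measure X} {I : X → EReal}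

theorem ae_expGrowthSup_le_of_isCompact {K : Set X} (hK : IsCompact K) {a : EReal}
    (h : ∀ x ∈ K, ∃ A ∈ 𝓝 x, ∀ᵐ ω ∂P, expGrowthSup (fun t => Q t ω A) ≤ a) :
    ∀ᵐ ω ∂P, expGrowthSup (fun t => Q t ω K) ≤ a := by
  refine hK.induction_on (p := fun A => ∀ᵐ ω ∂P, expGrowthSup (fun t => Q t ω A) ≤ a) ?_ ?_ ?_ ?_
  · refine ae_of_all _ fun ω => ?_
    simp only [measure_empty]
    exact expGrowthSup_zero.trans_le bot_le
  · intro A B hAB hB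
    filter_upwards [hB] with ω hω
    exact (expGrowthSup_monotone fun t => measure_mono hAB).trans hω
  · intro A B hA hB
    filter_upwards [hA, hB] with ω hωA hωB
    calc expGrowthSup (fun t => Q t ω (A ∪ B))
        ≤ expGrowthSup ((fun t => Q t ω A) + fun t => Q t ω B) :=
          expGrowthSup_monotone fun t => measure_union_le A B
      _ ≤ a := by rw [expGrowthSup_add]; exact sup_le hωA hωB
  · intro x hx
    obtain ⟨A, hA, hle⟩ := h x hx
    exact ⟨A, mem_nhdsWithin_of_mem_nhds hA, hle⟩

theorem ae_expGrowthSup_le_of_isClosed {K : Set X} (hK : IsCompact K)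
    (hQK : ∀ᵐ ω ∂P, ∀ᶠ t in atTop, Q t ω Kᶜ = 0)
    (hloc : ∀ x, ∀ a : ℝ, a < I x →
      ∃ A ∈ 𝓝 x, ∀ᵐ ω ∂P, expGrowthSup (fun t => Q t ω A) ≤ -(a : EReal))
    {F : Set X} (hF : IsClosed F) :
    ∀ᵐ ω ∂P, expGrowthSup (fun t => Q t ω F) ≤ -(⨅ x ∈ F, I x) := by
  refine ae_le_of_forall_gt fun a ha => ?_
  have hcompact : ∀ᵐ ω ∂P, expGrowthSup (fun t => Q t ω (K ∩ F)) ≤ a := by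
    refine ae_expGrowthSup_le_of_isCompact (hK.inter_right hF) fun x hx => ?_
    have hx' : ((-a : ℝ) : EReal) < I x := (EReal.neg_lt_comm.1 ha).trans_le (iInf₂_le x hx.2)
    simpa only [EReal.coe_neg, neg_neg] using hloc x (-a) hx'
  filter_upwards [hcompact, hQK] with ω hω hωK
  refine (expGrowthSup_eventually_monotone (hωK.mono fun t ht => ?_)).trans hω
  calc Q t ω F ≤ Q t ω (F ∩ K) + Q t ω (F \ K) := measure_le_inter_add_sdiff _ _ _
    _ = Q t ω (K ∩ F) := by
      rw [measure_mono_null (Set.sdiff_subset_compl F K) ht, add_zero, Set.inter_comm]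

theorem ae_le_expGrowthInf_of_isOpen
    (hloc : ∀ x, ∀ b : ℝ, I x < b → ∀ E ∈ 𝓝 x,
      ∀ᵐ ω ∂P, -(b : EReal) ≤ expGrowthInf (fun t => Q t ω E))
    {E : Set X} (hE : IsOpen E) :
    ∀ᵐ ω ∂P, -(⨅ x ∈ E, I x) ≤ expGrowthInf (fun t => Q t ω E) := by
  have hneg : ∀ᵐ ω ∂P, -expGrowthInf (fun t => Q t ω E) ≤ ⨅ x ∈ E, I x := by
    refine ae_le_of_forall_gt fun b hb => ?_
    obtain ⟨x, hxE, hxb⟩ := by simpa only [iInf_lt_iff, exists_prop] using hb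
    filter_upwards [hloc x b hxb E (hE.mem_nhds hxE)] with ω hω using EReal.neg_le.1 hω
  filter_upwards [hneg] with ω hω using EReal.neg_le.1 hω

end LargeDeviations

section HitCount

variable {ι Ω E : Type*} [MeasurableSpace Ω] {P : Measure Ω}

theorem ae_eventually_notMem_of_eventually_le_exp [IsFiniteMeasure P] {A : ℕ → Set Ω} {C c : ℝ}
    (hc : 0 < c) (h : ∀ᶠ t : ℕ in atTop, P.real (A t) ≤ C * Real.exp (-(t * c))) :
    ∀ᵐ ω ∂P, ∀ᶠ t in atTop, ω ∉ A t := by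
  have hexp : Summable fun t : ℕ => C * Real.exp (-(t * c)) := by
    simp only [← mul_neg]
    exact (Real.summable_exp_nat_mul_iff.2 (neg_lt_zero.2 hc)).mul_left C
  have hsum : Summable fun t => P.real (A t) :=
    hexp.of_norm_bounded_eventually_nat (h.mono fun t ht => by
      rwa [Real.norm_of_nonneg measureReal_nonneg])
  refine ae_eventually_notMem ?_
  simpa only [ofReal_measureReal (measure_ne_top P _)] using hsum.tsum_ofReal_ne_top

open Classical in
/-- The number of indices `s ∈ G` with `z s ∈ W`. -/
def hitCount (G : Finset ι) (W : Set E) (z : ι → E) : ℕ := (G.filter fun s => z s ∈ W).card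

theorem hitCount_eq_sum {R : Type*} [NonAssocSemiring R] (G : Finset ι) (W : Set E) (z : ι → E) :
    (hitCount G W z : R) = ∑ s ∈ G, W.indicator 1 (z s) := by
  classical
  simp only [hitCount, Finset.natCast_card_filter, Set.indicator_apply, Pi.one_apply]

theorem hitCount_eq_zero {G : Finset ι} {W : Set E} {z : ι → E} (h : ∀ s ∈ G, z s ∉ W) :
    hitCount G W z = 0 := by
  classical
  exact Finset.card_eq_zero.2 (Finset.filter_eq_empty_iff.2 h)

theorem hitCount_pos {G : Finset ι} {W : Set E} {z : ι → E} {s : ι} (hs : s ∈ G) (h : z s ∈ W) :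
    0 < hitCount G W z := by
  classical
  exact Finset.card_pos.2 ⟨s, Finset.mem_filter.2 ⟨hs, h⟩⟩

variable [MeasurableSpace E] {G : Finset ι} {Y : ι → Ω → E} {W : Set E}

theorem integral_indicator_one_comp {X : Ω → E} (hX : AEMeasurable X P) (hW : MeasurableSet W) :
    ∫ ω, W.indicator (1 : E → ℝ) (X ω) ∂P = P.real {ω | X ω ∈ W} := by
  rw [← integral_map (f := W.indicator 1) hX
    (stronglyMeasurable_one.indicator hW).aestronglyMeasurable, integral_indicator_one hW,
    map_measureReal_apply_of_aemeasurable hX hW]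
  rfl

theorem memLp_indicator_one_comp [IsFiniteMeasure P] {X : Ω → E} (hX : AEMeasurable X P)
    (hW : MeasurableSet W) (q : ENNReal) :
    MemLp (fun ω => W.indicator (1 : E → ℝ) (X ω)) q P :=
  MemLp.of_bound ((measurable_one.indicator hW).comp_aemeasurable hX).aestronglyMeasurable 1
    (ae_of_all _ fun ω => (norm_indicator_le_norm_self _ _).trans (by simp))

theorem integral_hitCount [IsFiniteMeasure P] (hY : ∀ s ∈ G, AEMeasurable (Y s) P)
    (hW : MeasurableSet W) :
    ∫ ω, (hitCount G W (Y · ω) : ℝ) ∂P = ∑ s ∈ G, P.real {ω | Y s ω ∈ W} := by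
  simp only [hitCount_eq_sum]
  rw [integral_finsetSum _ fun s hs => (memLp_indicator_one_comp (hY s hs) hW 1).integrable le_rfl]
  exact Finset.sum_congr rfl fun s hs => integral_indicator_one_comp (hY s hs) hW

theorem memLp_hitCount [IsFiniteMeasure P] (hY : ∀ s ∈ G, AEMeasurable (Y s) P)
    (hW : MeasurableSet W) (q : ENNReal) :
    MemLp (fun ω => (hitCount G W (Y · ω) : ℝ)) q P := by
  simp only [hitCount_eq_sum]
  exact memLp_finsetSum _ fun s hs => memLp_indicator_one_comp (hY s hs) hW q

theorem mul_measureReal_le_hitCount_le [IsFiniteMeasure P] (hY : ∀ s ∈ G, AEMeasurable (Y s) P)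
    (hW : MeasurableSet W) (a : ℝ) :
    a * P.real {ω | a ≤ hitCount G W (Y · ω)} ≤ ∑ s ∈ G, P.real {ω | Y s ω ∈ W} := by
  rw [← integral_hitCount hY hW]
  exact mul_meas_ge_le_integral_of_nonneg (ae_of_all _ fun ω => Nat.cast_nonneg _)
    ((memLp_hitCount hY hW 1).integrable le_rfl) a

theorem variance_hitCount_le [IsProbabilityMeasure P] (hY : ∀ s ∈ G, AEMeasurable (Y s) P)
    (hind : (G : Set ι).Pairwise fun s s' => IndepFun (Y s) (Y s') P) (hW : MeasurableSet W) :
    Var[fun ω => (hitCount G W (Y · ω) : ℝ); P] ≤ ∑ s ∈ G, P.real {ω | Y s ω ∈ W} := by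
  have hmeas : Measurable (W.indicator (1 : E → ℝ)) := measurable_one.indicator hW
  have hLp : ∀ s ∈ G, MemLp (fun ω => W.indicator (1 : E → ℝ) (Y s ω)) 2 P :=
    fun s hs => memLp_indicator_one_comp (hY s hs) hW 2
  have hsum : (fun ω => (hitCount G W (Y · ω) : ℝ)) =
      ∑ s ∈ G, fun ω => W.indicator (1 : E → ℝ) (Y s ω) := by
    ext ω; rw [hitCount_eq_sum, Finset.sum_apply]
  rw [hsum, IndepFun.variance_sum hLp fun s hs s' hs' hne => (hind hs hs' hne).comp hmeas hmeas]
  refine Finset.sum_le_sum fun s hs => (variance_le_expectation_sq (hLp s hs).1).trans_eq ?_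
  have hsq : (fun ω => W.indicator (1 : E → ℝ) (Y s ω)) ^ 2 =
      fun ω => W.indicator (1 : E → ℝ) (Y s ω) := by
    ext ω
    by_cases h : Y s ω ∈ W <;> simp [h]
  rw [hsq, integral_indicator_one_comp (hY s hs) hW]

theorem measureReal_hitCount_lt_half_le [IsProbabilityMeasure P]
    (hY : ∀ s ∈ G, AEMeasurable (Y s) P)
    (hind : (G : Set ι).Pairwise fun s s' => IndepFun (Y s) (Y s') P) (hW : MeasurableSet W)
    {m : ℝ} (hm : 0 < m) (hmean : m ≤ ∑ s ∈ G, P.real {ω | Y s ω ∈ W}) :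
    P.real {ω | (hitCount G W (Y · ω) : ℝ) < m / 2} ≤ 4 / m := by
  set μ := ∑ s ∈ G, P.real {ω | Y s ω ∈ W} with hμ
  have hμ0 : 0 < μ := hm.trans_le hmean
  have hcheb := meas_ge_le_variance_div_sq (memLp_hitCount hY hW 2) (half_pos hμ0)
  rw [integral_hitCount hY hW, ← hμ] at hcheb
  have hsub : {ω | (hitCount G W (Y · ω) : ℝ) < m / 2} ⊆
      {ω | μ / 2 ≤ |(hitCount G W (Y · ω) : ℝ) - μ|} := fun ω hω => by
    have hlt : (hitCount G W (Y · ω) : ℝ) < m / 2 := hω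
    rw [Set.mem_ofPred_eq, le_abs]
    right; linarith
  calc P.real {ω | (hitCount G W (Y · ω) : ℝ) < m / 2}
      ≤ P.real {ω | μ / 2 ≤ |(hitCount G W (Y · ω) : ℝ) - μ|} := measureReal_mono hsub
    _ ≤ Var[fun ω => (hitCount G W (Y · ω) : ℝ); P] / (μ / 2) ^ 2 :=
      ENNReal.toReal_le_of_le_ofReal (div_nonneg (variance_nonneg _ _) (sq_nonneg _)) hcheb
    _ ≤ μ / (μ / 2) ^ 2 := by gcongr; exact variance_hitCount_le hY hind hW
    _ = 4 / μ := by field_simp; norm_num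
    _ ≤ 4 / m := by gcongr

end HitCount

section TriangularArray

variable {ι : ℕ → Type*} {Ω E : Type*} [MeasurableSpace Ω] [MeasurableSpace E] {P : Measure Ω}
  {G : (t : ℕ) → Finset (ι t)} {Y : (t : ℕ) → ι t → Ω → E} {W : Set E} {h j : ℝ}

theorem ae_eventually_hitCount_lt [IsFiniteMeasure P]
    (hY : ∀ᶠ t : ℕ in atTop, ∀ s ∈ G t, AEMeasurable (Y t s) P) (hW : MeasurableSet W) {a M : ℝ}
    (hM : 0 ≤ M) (ha : h - j < a) (hcard : ∀ᶠ t : ℕ in atTop, ((G t).card : ℝ) ≤ Real.exp (t * h))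
    (hprob : ∀ᶠ t : ℕ in atTop, ∀ s ∈ G t, P.real {ω | Y t s ω ∈ W} ≤ M * Real.exp (-(t * j))) :
    ∀ᵐ ω ∂P, ∀ᶠ t : ℕ in atTop, (hitCount (G t) W (Y t · ω) : ℝ) < Real.exp (t * a) := by
  have hbound : ∀ᶠ t : ℕ in atTop, P.real {ω | Real.exp (t * a) ≤ hitCount (G t) W (Y t · ω)} ≤
      M * Real.exp (-(t * (a - (h - j)))) := by
    filter_upwards [hY, hcard, hprob] with t hYt hcard_t hprob_t
    refine le_of_mul_le_mul_left ?_ (Real.exp_pos (t * a))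
    calc Real.exp (t * a) * P.real {ω | Real.exp (t * a) ≤ hitCount (G t) W (Y t · ω)}
        ≤ ∑ s ∈ G t, P.real {ω | Y t s ω ∈ W} := mul_measureReal_le_hitCount_le hYt hW _
      _ ≤ (G t).card * (M * Real.exp (-(t * j))) := by
        rw [← nsmul_eq_mul]; exact Finset.sum_le_card_nsmul _ _ _ hprob_t
      _ ≤ Real.exp (t * h) * (M * Real.exp (-(t * j))) := by gcongr
      _ = Real.exp (t * a) * (M * Real.exp (-(t * (a - (h - j))))) := by
        rw [mul_left_comm, ← Real.exp_add, mul_left_comm, ← Real.exp_add]; ring_nf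
  filter_upwards [ae_eventually_notMem_of_eventually_le_exp (sub_pos.2 ha) hbound] with ω hω
  exact hω.mono fun t ht => not_le.1 ht

theorem ae_eventually_le_hitCount [IsProbabilityMeasure P]
    (hY : ∀ᶠ t : ℕ in atTop, ∀ s ∈ G t, AEMeasurable (Y t s) P)
    (hind : ∀ᶠ t : ℕ in atTop, (G t : Set (ι t)).Pairwise fun s s' => IndepFun (Y t s) (Y t s') P)
    (hW : MeasurableSet W) {κ : ℝ} (hκ : 0 < κ) (hjh : j < h)
    (hcard : ∀ᶠ t : ℕ in atTop, Real.exp (t * h) ≤ (G t).card)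
    (hprob : ∀ᶠ t : ℕ in atTop, ∀ s ∈ G t, κ * Real.exp (-(t * j)) ≤ P.real {ω | Y t s ω ∈ W}) :
    ∀ᵐ ω ∂P, ∀ᶠ t : ℕ in atTop, κ * Real.exp (t * (h - j)) / 2 ≤ hitCount (G t) W (Y t · ω) := by
  have hbound : ∀ᶠ t : ℕ in atTop,
      P.real {ω | (hitCount (G t) W (Y t · ω) : ℝ) < κ * Real.exp (t * (h - j)) / 2} ≤
        4 / κ * Real.exp (-(t * (h - j))) := by
    filter_upwards [hY, hind, hcard, hprob] with t hYt hind_t hcard_t hprob_t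
    have hmean : κ * Real.exp (t * (h - j)) ≤ ∑ s ∈ G t, P.real {ω | Y t s ω ∈ W} :=
      calc κ * Real.exp (t * (h - j)) = Real.exp (t * h) * (κ * Real.exp (-(t * j))) := by
            rw [mul_left_comm, ← Real.exp_add]; ring_nf
        _ ≤ (G t).card * (κ * Real.exp (-(t * j))) := by gcongr
        _ ≤ ∑ s ∈ G t, P.real {ω | Y t s ω ∈ W} := by
          rw [← nsmul_eq_mul]; exact Finset.card_nsmul_le_sum _ _ _ hprob_t
    refine (measureReal_hitCount_lt_half_le hYt hind_t hW (by positivity) hmean).trans_eq ?_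
    rw [Real.exp_neg, div_mul_eq_div_div, div_eq_mul_inv (4 / κ)]
  filter_upwards [ae_eventually_notMem_of_eventually_le_exp (sub_pos.2 hjh) hbound] with ω hω
  exact hω.mono fun t ht => not_lt.1 ht

end TriangularArray

section Gaussian

open NNReal

variable {Ω : Type*} [MeasurableSpace Ω] {P : Measure Ω} {X : Ω → ℝ} {v c : ℝ≥0}

theorem hasSubgaussianMGF_of_hasLaw_gaussianReal (hX : HasLaw X (gaussianReal 0 v) P)
    (hvc : v ≤ c) : HasSubgaussianMGF X c P where
  integrable_exp_mul r := by
    have h := integrable_exp_mul_gaussianReal (μ := 0) (v := v) r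
    rwa [← hX.map_eq, integrable_map_measure (by fun_prop) hX.aemeasurable] at h
  mgf_le r := by
    rw [mgf_gaussianReal hX.map_eq, Real.exp_le_exp, zero_mul, zero_add]
    gcongr

theorem measureReal_le_abs_le_of_hasSubgaussianMGF [IsFiniteMeasure P]
    (hX : HasSubgaussianMGF X c P) {r : ℝ} (hr : 0 ≤ r) :
    P.real {ω | r ≤ |X ω|} ≤ 2 * Real.exp (-(r ^ 2 / (2 * c))) := by
  have hunion : {ω | r ≤ |X ω|} = {ω | r ≤ X ω} ∪ {ω | r ≤ (-X) ω} := by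
    ext ω; exact le_abs (a := r) (b := X ω)
  rw [hunion, two_mul, ← neg_div]
  exact (measureReal_union_le _ _).trans
    (add_le_add (hX.measure_ge_le hr) (hX.neg.measure_ge_le hr))

theorem gaussianPDFReal_zero_le_of_abs_le {x y : ℝ} (h : |x| ≤ |y|) :
    gaussianPDFReal 0 v y ≤ gaussianPDFReal 0 v x := by
  simp only [gaussianPDFReal, sub_zero]
  have hsq : x ^ 2 ≤ y ^ 2 := sq_le_sq.2 h
  gcongr

theorem mul_gaussianPDFReal_le_measureReal_abs_sub_lt (hX : HasLaw X (gaussianReal 0 v) P)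
    (hv : v ≠ 0) (ξ : ℝ) {δ : ℝ} (hδ : 0 ≤ δ) :
    2 * δ * gaussianPDFReal 0 v (|ξ| + δ) ≤ P.real {ω | |X ω - ξ| < δ} := by
  have hball : {x : ℝ | |x - ξ| < δ} = Metric.ball ξ δ := by
    ext x; rw [Metric.mem_ball, Real.dist_eq]; rfl
  have hpdf : ∀ x ∈ Metric.ball ξ δ, gaussianPDFReal 0 v (|ξ| + δ) ≤ gaussianPDFReal 0 v x := by
    intro x hx
    rw [Metric.mem_ball, Real.dist_eq] at hx
    refine gaussianPDFReal_zero_le_of_abs_le ?_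
    rw [abs_of_nonneg (add_nonneg (abs_nonneg ξ) hδ)]
    linarith [abs_sub_abs_le_abs_sub x ξ]
  rw [hX.measureReal_eq (p := fun x => |x - ξ| < δ) (by rw [hball]; exact measurableSet_ball),
    hball, measureReal_def, gaussianReal_apply_eq_integral 0 hv, ENNReal.toReal_ofReal
      (integral_nonneg (gaussianPDFReal_nonneg 0 v)), mul_comm]
  have hvol : volume.real (Metric.ball ξ δ) = 2 * δ := Real.volume_real_ball hδ
  rw [← hvol]
  exact setIntegral_ge_of_const_le_real measurableSet_ball measure_ball_lt_top.ne hpdf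
    (integrable_gaussianPDFReal 0 v).integrableOn

end Gaussian

section EmpiricalMeasure

open ExpGrowth

theorem exp_coe_mul_natCast (a : ℝ) (t : ℕ) :
    EReal.exp (a * t) = ENNReal.ofReal (Real.exp (t * a)) := by
  rw [mul_comm (t : ℝ), ← EReal.exp_coe, EReal.coe_mul, EReal.coe_natCast]

theorem expGrowthSup_natCast_le {n : ℕ → ℕ} {a : ℝ}
    (h : ∀ᶠ t : ℕ in atTop, (n t : ℝ) ≤ Real.exp (t * a)) :
    expGrowthSup (fun t => (n t : ENNReal)) ≤ a := by
  refine Eventually.expGrowthSup_le (h.mono fun t ht => ?_)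
  rw [exp_coe_mul_natCast, ← ENNReal.ofReal_natCast]
  exact ENNReal.ofReal_le_ofReal ht

theorem le_expGrowthInf_natCast {n : ℕ → ℕ} {a κ : ℝ} (hκ : 0 < κ)
    (h : ∀ᶠ t : ℕ in atTop, κ * Real.exp (t * a) ≤ n t) :
    a ≤ expGrowthInf (fun t => (n t : ENNReal)) := by
  refine expGrowthInf_exp.symm.trans_le (expGrowthInf_of_eventually_ge (b := ENNReal.ofReal κ)
    (ENNReal.ofReal_pos.2 hκ).ne' (h.mono fun t ht => ?_))
  rw [exp_coe_mul_natCast, ← ENNReal.ofReal_mul hκ.le, ← ENNReal.ofReal_natCast]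
  exact ENNReal.ofReal_le_ofReal ht

variable {Δ : ℕ} {p : Fin 2 → Fin Δ → ℝ} {ψ : ℝ} {U : Set (Fin 2 → Fin Δ → ℝ)} {W : Set ℝ}
  {z : (t : ℕ) → (Fin t → Fin 2) → ℝ}

theorem empMeasure_prod (p : Fin 2 → Fin Δ → ℝ) (U : Set (Fin 2 → Fin Δ → ℝ)) (W : Set ℝ) {t : ℕ}
    (z : (Fin t → Fin 2) → ℝ) :
    empMeasure p t z (U ×ˢ W) = hitCount (typeClass p t U) W z / (feasible p t).card := by
  classical
  rw [empMeasure, Measure.smul_apply, Measure.finsetSum_apply, smul_eq_mul, ENNReal.div_eq_inv_mul,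
    hitCount_eq_sum, typeClass, Finset.sum_filter]
  refine congrArg _ (Finset.sum_congr rfl fun s _ => ?_)
  by_cases hU : seqType Δ s ∈ U <;> simp [Set.indicator_apply, hU]

theorem expGrowthSup_card_feasible_le (hp : ∀ m d, 0 < p m d) (hψ : 0 < ψ)
    (hroot : ψ ^ Δ = ∑ i ∈ Finset.range Δ, ψ ^ i) :
    expGrowthSup (fun t => ((feasible p t).card : ENNReal)) ≤ Real.log ψ :=
  expGrowthSup_natCast_le ((eventually_ge_atTop 1).mono fun _ => card_feasible_le hp hψ hroot)

theorem le_expGrowthInf_card_feasible (hp : ∀ m d, 0 < p m d) (hψ : 0 < ψ)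
    (hroot : ψ ^ Δ = ∑ i ∈ Finset.range Δ, ψ ^ i) :
    Real.log ψ ≤ expGrowthInf (fun t => ((feasible p t).card : ENNReal)) := by
  obtain ⟨κ, hκ, hcard⟩ := exists_mul_exp_le_card_feasible hp hψ hroot
  exact le_expGrowthInf_natCast hκ ((eventually_ge_atTop 1).mono hcard)

theorem expGrowthSup_empMeasure_prod_le (hp : ∀ m d, 0 < p m d) (hψ : 0 < ψ)
    (hroot : ψ ^ Δ = ∑ i ∈ Finset.range Δ, ψ ^ i) :
    expGrowthSup (fun t => empMeasure p t (z t) (U ×ˢ W)) ≤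
      expGrowthSup (fun t => (hitCount (typeClass p t U) W (z t) : ENNReal)) - Real.log ψ := by
  have hinf := le_expGrowthInf_card_feasible hp hψ hroot
  have hinf_le := expGrowthInf_le_expGrowthSup.trans (expGrowthSup_card_feasible_le hp hψ hroot)
  have hinv : expGrowthSup (fun t => ((feasible p t).card : ENNReal))⁻¹ = (-Real.log ψ : ℝ) := by
    rw [expGrowthSup_inv, le_antisymm hinf_le hinf, EReal.coe_neg]
  rw [sub_eq_add_neg, ← EReal.coe_neg, ← hinv]
  simp only [empMeasure_prod, div_eq_mul_inv]
  exact expGrowthSup_mul_le (Or.inr (hinv.trans_ne (EReal.coe_ne_top _)))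
    (Or.inr (hinv.trans_ne (EReal.coe_ne_bot _)))

theorem le_expGrowthInf_empMeasure_prod (hp : ∀ m d, 0 < p m d) (hψ : 0 < ψ)
    (hroot : ψ ^ Δ = ∑ i ∈ Finset.range Δ, ψ ^ i) :
    expGrowthInf (fun t => (hitCount (typeClass p t U) W (z t) : ENNReal)) - Real.log ψ ≤
      expGrowthInf (fun t => empMeasure p t (z t) (U ×ˢ W)) := by
  have hinv : -(Real.log ψ : EReal) ≤
      expGrowthInf (fun t => ((feasible p t).card : ENNReal))⁻¹ := by
    rw [expGrowthInf_inv]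
    exact EReal.neg_le_neg_iff.2 (expGrowthSup_card_feasible_le hp hψ hroot)
  rw [sub_eq_add_neg]
  simp only [empMeasure_prod, div_eq_mul_inv]
  exact (add_le_add le_rfl hinv).trans le_expGrowthInf_mul

end EmpiricalMeasure

section Rate

variable {Δ : ℕ} {ψ σ : ℝ} {ν : Fin 2 → Fin Δ → ℝ} {ξ : ℝ} {x : (Fin 2 → Fin Δ → ℝ) × ℝ}

theorem gaussRate_nonneg (σ : ℝ) (hν : ν ∈ typeSet Δ) (ξ : ℝ) : 0 ≤ gaussRate σ ν ξ := by
  have hq := qDot_pos_of_mem_typeSet hν 1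
  unfold gaussRate; positivity

theorem gaussRate_pos (hσ : σ ≠ 0) (hν : ν ∈ typeSet Δ) (hξ : ξ ≠ 0) : 0 < gaussRate σ ν ξ := by
  have hq := qDot_pos_of_mem_typeSet hν 1
  unfold gaussRate; positivity

theorem gaussRate_mul (σ : ℝ) (ν : Fin 2 → Fin Δ → ℝ) (r ξ : ℝ) :
    gaussRate σ ν (r * ξ) = r ^ 2 * gaussRate σ ν ξ := by
  rw [gaussRate, gaussRate, mul_pow, mul_div_assoc]

theorem gaussRate_abs (σ : ℝ) (ν : Fin 2 → Fin Δ → ℝ) (ξ : ℝ) :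
    gaussRate σ ν |ξ| = gaussRate σ ν ξ := by
  rw [gaussRate, gaussRate, sq_abs]

theorem continuousAt_gaussRate (hσ : σ ≠ 0) (hx : x.1 ∈ typeSet Δ) :
    ContinuousAt (fun y : (Fin 2 → Fin Δ → ℝ) × ℝ => gaussRate σ y.1 y.2) x := by
  have hq := qDot_pos_of_mem_typeSet hx 1
  have hcont : Continuous fun y : (Fin 2 → Fin Δ → ℝ) × ℝ => qDot (y.1 1) :=
    continuous_qDot.comp ((continuous_apply 1).comp continuous_fst)
  exact (continuous_snd.pow 2).continuousAt.div (continuous_const.mul hcont).continuousAt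
    (by positivity)

/-- The effective domain of `rate ψ σ`, i.e. the set where it is finite: the types `ν` and values
`ξ` such that the exponential number of sequences of type close to `ν` outweighs the exponentially
small probability that `Z` is close to `ξ`. -/
def rateDomain (Δ : ℕ) (σ : ℝ) : Set ((Fin 2 → Fin Δ → ℝ) × ℝ) :=
  {x | x.1 ∈ typeSet Δ ∧ gaussRate σ x.1 x.2 ≤ totalEntropy x.1}

theorem rate_of_mem (ψ : ℝ) (hx : x ∈ rateDomain Δ σ) :
    rate ψ σ x = (Real.log ψ - totalEntropy x.1 + gaussRate σ x.1 x.2 : ℝ) :=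
  (if_pos hx).trans (by rw [totalEntropy, sub_sub])

theorem rate_of_notMem (ψ : ℝ) (hx : x ∉ rateDomain Δ σ) : rate ψ σ x = ⊤ :=
  if_neg hx

theorem isClosed_rateDomain (Δ : ℕ) (hσ : σ ≠ 0) : IsClosed (rateDomain Δ σ) :=
  ((isClosed_typeSet Δ).preimage continuous_fst).isClosed_le
    (fun _ hx => (continuousAt_gaussRate hσ hx).continuousWithinAt)
    ((continuousOn_totalEntropy Δ).comp continuousOn_fst fun _ hx => hx)

theorem rate_nonneg (hψ : 0 < ψ) (hroot : ψ ^ Δ = ∑ i ∈ Finset.range Δ, ψ ^ i) (σ : ℝ)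
    (x : (Fin 2 → Fin Δ → ℝ) × ℝ) : 0 ≤ rate ψ σ x := by
  by_cases hx : x ∈ rateDomain Δ σ
  · rw [rate_of_mem ψ hx, EReal.coe_nonneg]
    linarith [totalEntropy_le_log hψ hroot hx.1, gaussRate_nonneg σ hx.1 x.2]
  · rw [rate_of_notMem ψ hx]; exact le_top

theorem lowerSemicontinuous_of_isClosed {X : Type*} [TopologicalSpace X] {f : X → EReal}
    {g : X → ℝ} {K : Set X} (hK : IsClosed K) (hg : ContinuousOn g K)
    (hfg : ∀ x ∈ K, f x = g x) (htop : ∀ x ∉ K, f x = ⊤) : LowerSemicontinuous f := by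
  intro x y hy
  by_cases hx : x ∈ K
  · have hcont : ContinuousWithinAt (fun x => (g x : EReal)) K x :=
      continuous_coe_real_ereal.continuousAt.comp_continuousWithinAt (hg x hx)
    have hnear : ∀ᶠ x' in 𝓝[K] x, y < g x' :=
      hcont.eventually_const_lt (hy.trans_eq (hfg x hx))
    filter_upwards [eventually_nhdsWithin_iff.1 hnear] with x' hx'
    by_cases hK' : x' ∈ K
    · exact hfg x' hK' ▸ hx' hK'
    · exact htop x' hK' ▸ hy.trans_le le_top
  · filter_upwards [hK.isOpen_compl.mem_nhds hx] with x' hx'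
    rwa [htop x' hx', ← htop x hx]

theorem lowerSemicontinuous_rate (ψ : ℝ) (hσ : σ ≠ 0) :
    LowerSemicontinuous (rate ψ σ : (Fin 2 → Fin Δ → ℝ) × ℝ → EReal) := by
  refine lowerSemicontinuous_of_isClosed (isClosed_rateDomain Δ hσ) (ContinuousOn.add ?_ ?_)
    (fun _ => rate_of_mem ψ) fun _ => rate_of_notMem ψ
  · exact continuousOn_const.sub
      ((continuousOn_totalEntropy Δ).comp continuousOn_fst fun _ hx => hx.1)
  · exact fun x hx => (continuousAt_gaussRate hσ hx.1).continuousWithinAt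

end Rate

/-- `Z t s ∼ 𝒩(0, σ² Θ₂(s) / t)` for every feasible sequence `s` of length `t ≥ 1`: the marginal
laws of the values attached to the feasible sequences. -/
def IsGaussianField {Δ : ℕ} (p : Fin 2 → Fin Δ → ℝ) (σ : ℝ) {Ω : Type*} [MeasurableSpace Ω]
    (P : Measure Ω) (Z : (t : ℕ) → (Fin t → Fin 2) → Ω → ℝ) : Prop :=
  ∀ t, 1 ≤ t → ∀ s ∈ feasible p t,
    HasLaw (Z t s) (gaussianReal 0 (σ ^ 2 * fracState2 s / t).toNNReal) P

section FracState2

variable {t : ℕ}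

theorem fracState2_nonneg (s : Fin t → Fin 2) : 0 ≤ fracState2 s := by
  unfold fracState2; positivity

theorem fracState2_le_one (s : Fin t → Fin 2) : fracState2 s ≤ 1 := by
  refine div_le_one_of_le₀ (Nat.cast_le.2 ?_) t.cast_nonneg
  exact (Finset.card_filter_le _ _).trans (Finset.card_fin t).le

end FracState2

namespace IsGaussianField

variable {Δ t : ℕ} {p : Fin 2 → Fin Δ → ℝ} {σ : ℝ} {Ω : Type*} [MeasurableSpace Ω]
  {P : Measure Ω} {Z : (t : ℕ) → (Fin t → Fin 2) → Ω → ℝ} {s : Fin t → Fin 2}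
  {ν : Fin 2 → Fin Δ → ℝ} {ξ c : ℝ}

theorem eventually_aemeasurable_typeClass (hZ : IsGaussianField p σ P Z)
    (U : Set (Fin 2 → Fin Δ → ℝ)) :
    ∀ᶠ t : ℕ in atTop, ∀ s ∈ typeClass p t U, AEMeasurable (Z t s) P := by
  filter_upwards [eventually_ge_atTop 1] with t ht s hs
  exact (hZ t ht s (mem_typeClass.1 hs).1).aemeasurable

theorem measureReal_le_abs_le [IsFiniteMeasure P] (hZ : IsGaussianField p σ P Z) (ht : 1 ≤ t)
    (hs : s ∈ feasible p t) {θ r : ℝ} (hθ : fracState2 s ≤ θ) (hr : 0 ≤ r) :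
    P.real {ω | r ≤ |Z t s ω|} ≤ 2 * Real.exp (-(t * (r ^ 2 / (2 * σ ^ 2 * θ)))) := by
  have hθ0 := (fracState2_nonneg s).trans hθ
  have hsub : HasSubgaussianMGF (Z t s) (σ ^ 2 * θ / t).toNNReal P :=
    hasSubgaussianMGF_of_hasLaw_gaussianReal (hZ t ht s hs) (Real.toNNReal_le_toNNReal (by gcongr))
  refine (measureReal_le_abs_le_of_hasSubgaussianMGF hsub hr).trans_eq ?_
  rw [Real.coe_toNNReal _ (by positivity)]
  congr 3
  rw [← mul_div_assoc, ← mul_div_assoc, div_div_eq_mul_div, ← mul_assoc, mul_comm (r ^ 2)]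

theorem measureReal_le_gaussRate_le [IsFiniteMeasure P] (hZ : IsGaussianField p σ P Z)
    (hσ : σ ≠ 0) (ht : 1 ≤ t) (hs : s ∈ feasible p t) (hpos : 0 < qDot (seqType Δ s 1)) (c : ℝ) :
    P.real {ω | c ≤ gaussRate σ (seqType Δ s) (Z t s ω)} ≤ 2 * Real.exp (-(t * c)) := by
  set θ := qDot (seqType Δ s 1)
  have hscale : 0 < 2 * σ ^ 2 * θ := by positivity
  have hsub : {ω | c ≤ gaussRate σ (seqType Δ s) (Z t s ω)} ⊆
      {ω | √(c * (2 * σ ^ 2 * θ)) ≤ |Z t s ω|} := fun ω hω =>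
    Real.sqrt_le_iff.2 ⟨abs_nonneg _, (sq_abs (Z t s ω)).symm ▸ (le_div_iff₀ hscale).1 hω⟩
  refine (measureReal_mono hsub).trans
    ((hZ.measureReal_le_abs_le ht hs (fracState2_eq_qDot hs).le (Real.sqrt_nonneg _)).trans ?_)
  gcongr
  rw [le_div_iff₀ hscale, Real.sq_sqrt']
  exact le_max_left _ _

theorem exists_nhds_measureReal_le [IsFiniteMeasure P] (hZ : IsGaussianField p σ P Z)
    (hσ : σ ≠ 0) (hν : ν ∈ typeSet Δ) (hc : c < gaussRate σ ν ξ) :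
    ∃ U ∈ 𝓝 ν, ∃ W ∈ 𝓝 ξ, MeasurableSet W ∧ ∀ t, 1 ≤ t → ∀ s ∈ typeClass p t U,
      P.real {ω | Z t s ω ∈ W} ≤ 2 * Real.exp (-(t * c)) := by
  have hpos : ∀ᶠ V in 𝓝 ν, 0 < qDot (V 1) :=
    (continuous_qDot.comp (continuous_apply 1)).continuousAt.eventually_const_lt
      (qDot_pos_of_mem_typeSet hν 1)
  have hrate : ∀ᶠ x in 𝓝 (ν, ξ), c < gaussRate σ x.1 x.2 :=
    (continuousAt_gaussRate hσ hν).eventually_const_lt hc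
  obtain ⟨U, W, hU, hνU, hW, hξW, hUW⟩ := mem_nhds_prod_iff'.1 hrate
  refine ⟨U ∩ {V | 0 < qDot (V 1)}, inter_mem (hU.mem_nhds hνU) hpos, W, hW.mem_nhds hξW,
    hW.measurableSet, fun t ht s hs => ?_⟩
  obtain ⟨hs, hsU, hspos⟩ := mem_typeClass.1 hs
  have hsub : {ω | Z t s ω ∈ W} ⊆ {ω | c ≤ gaussRate σ (seqType Δ s) (Z t s ω)} := fun ω hω => by
    have hlt : c < gaussRate σ (seqType Δ s) (Z t s ω) := hUW (Set.mk_mem_prod hsU hω)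
    exact hlt.le
  exact (measureReal_mono hsub).trans (hZ.measureReal_le_gaussRate_le hσ ht hs hspos c)

theorem mul_exp_le_measureReal_abs_sub_lt (hZ : IsGaussianField p σ P Z) (hσ : σ ≠ 0)
    (ht : 1 ≤ t) (hs : s ∈ feasible p t) (hpos : 0 < qDot (seqType Δ s 1)) (ξ : ℝ) {δ : ℝ}
    (hδ : 0 ≤ δ) :
    2 * δ * (√(2 * Real.pi * σ ^ 2))⁻¹ * Real.exp (-(t * gaussRate σ (seqType Δ s) (|ξ| + δ))) ≤
      P.real {ω | |Z t s ω - ξ| < δ} := by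
  have ht0 : (1 : ℝ) ≤ t := by exact_mod_cast ht
  have hfrac : 0 < fracState2 s := by rwa [fracState2_eq_qDot hs]
  have hv : 0 < σ ^ 2 * fracState2 s / t := by positivity
  refine le_trans ?_ (mul_gaussianPDFReal_le_measureReal_abs_sub_lt (hZ t ht s hs)
    (Real.toNNReal_pos.2 hv).ne' ξ hδ)
  have hvar : σ ^ 2 * fracState2 s / t ≤ σ ^ 2 :=
    (div_le_self (by positivity) ht0).trans
      (mul_le_of_le_one_right (by positivity) (fracState2_le_one s))
  have hexponent : -(t * gaussRate σ (seqType Δ s) (|ξ| + δ)) =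
      -(|ξ| + δ) ^ 2 / (2 * (σ ^ 2 * fracState2 s / t)) := by
    rw [gaussRate, ← fracState2_eq_qDot hs]
    field_simp
  rw [gaussianPDFReal, Real.coe_toNNReal _ hv.le, sub_zero, hexponent, mul_assoc]
  gcongr

theorem exists_nhds_le_measureReal [IsFiniteMeasure P] (hZ : IsGaussianField p σ P Z)
    (hσ : σ ≠ 0) (hν : ν ∈ typeSet Δ) (hc : gaussRate σ ν ξ < c) {W : Set ℝ} (hW : W ∈ 𝓝 ξ) :
    ∃ κ > 0, ∃ U ∈ 𝓝 ν, ∀ t, 1 ≤ t → ∀ s ∈ typeClass p t U,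
      κ * Real.exp (-(t * c)) ≤ P.real {ω | Z t s ω ∈ W} := by
  have hpos : ∀ᶠ V in 𝓝 ν, 0 < qDot (V 1) :=
    (continuous_qDot.comp (continuous_apply 1)).continuousAt.eventually_const_lt
      (qDot_pos_of_mem_typeSet hν 1)
  have hrate : ∀ᶠ x in 𝓝 (ν, |ξ|), gaussRate σ x.1 x.2 < c :=
    (continuousAt_gaussRate (x := (ν, |ξ|)) hσ hν).eventually_lt_const
      ((gaussRate_abs σ ν ξ).trans_lt hc)
  obtain ⟨U, hU, W', hW', hUW⟩ := mem_nhds_prod_iff.1 hrate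
  obtain ⟨δ, hδ, hball⟩ := Metric.mem_nhds_iff.1 hW
  obtain ⟨δ', hδ', hball'⟩ := Metric.nhds_basis_closedBall.mem_iff.1 hW'
  set η := min δ δ'
  have hη0 : 0 < η := lt_min hδ hδ'
  have hηW' : |ξ| + η ∈ W' := hball' (by
    rw [Metric.mem_closedBall, Real.dist_eq, add_sub_cancel_left, abs_of_pos hη0]
    exact min_le_right _ _)
  refine ⟨2 * η * (√(2 * Real.pi * σ ^ 2))⁻¹, by positivity, U ∩ {V | 0 < qDot (V 1)},
    inter_mem hU hpos, fun t ht s hs => ?_⟩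
  obtain ⟨hs, hsU, hspos⟩ := mem_typeClass.1 hs
  have hle : gaussRate σ (seqType Δ s) (|ξ| + η) ≤ c := (hUW (Set.mk_mem_prod hsU hηW')).le
  calc 2 * η * (√(2 * Real.pi * σ ^ 2))⁻¹ * Real.exp (-(t * c))
      ≤ 2 * η * (√(2 * Real.pi * σ ^ 2))⁻¹ *
          Real.exp (-(t * gaussRate σ (seqType Δ s) (|ξ| + η))) := by gcongr
    _ ≤ P.real {ω | |Z t s ω - ξ| < η} :=
      hZ.mul_exp_le_measureReal_abs_sub_lt hσ ht hs hspos ξ hη0.le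
    _ ≤ P.real {ω | Z t s ω ∈ W} := measureReal_mono fun ω hω =>
      hball (Metric.mem_ball.2 (lt_of_lt_of_le hω (min_le_left _ _)))

end IsGaussianField

namespace IsGaussianField

open ExpGrowth

variable {Δ : ℕ} {p : Fin 2 → Fin Δ → ℝ} {σ ψ : ℝ} {Ω : Type*} [MeasurableSpace Ω]
  {P : Measure Ω} [IsProbabilityMeasure P] {Z : (t : ℕ) → (Fin t → Fin 2) → Ω → ℝ}
  {ν : Fin 2 → Fin Δ → ℝ} {ξ : ℝ} {x : (Fin 2 → Fin Δ → ℝ) × ℝ}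

theorem exists_nhds_ae_hitCount_lt (hZ : IsGaussianField p σ P Z) (hσ : σ ≠ 0)
    (hp : ∀ m d, 0 < p m d) (hν : ν ∈ typeSet Δ) {a : ℝ}
    (ha : totalEntropy ν - gaussRate σ ν ξ < a) :
    ∃ U ∈ 𝓝 ν, ∃ W ∈ 𝓝 ξ, ∀ᵐ ω ∂P, ∀ᶠ t : ℕ in atTop,
      (hitCount (typeClass p t U) W (Z t · ω) : ℝ) < Real.exp (t * a) := by
  obtain ⟨ε, hε, hεa⟩ : ∃ ε > 0, totalEntropy ν + ε - (gaussRate σ ν ξ - ε) < a :=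
    ⟨(a - (totalEntropy ν - gaussRate σ ν ξ)) / 3, by linarith, by linarith⟩
  obtain ⟨U₁, hU₁, hcard⟩ := exists_nhds_card_typeClass_le hp hν hε
  obtain ⟨U₂, hU₂, W, hW, hWm, hprob⟩ :=
    hZ.exists_nhds_measureReal_le hσ hν (sub_lt_self (gaussRate σ ν ξ) hε)
  refine ⟨U₁ ∩ U₂, inter_mem hU₁ hU₂, W, hW, ae_eventually_hitCount_lt
    (hZ.eventually_aemeasurable_typeClass _) hWm zero_le_two hεa ?_ ?_⟩
  · filter_upwards [eventually_ge_atTop 1] with t ht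
    refine (Nat.cast_le.2 (Finset.card_le_card ?_)).trans (hcard t ht)
    exact monotone_typeClass p t Set.inter_subset_left
  · filter_upwards [eventually_ge_atTop 1] with t ht s hs
    exact hprob t ht s (monotone_typeClass p t Set.inter_subset_right hs)

theorem exists_nhds_ae_hitCount_le (hZ : IsGaussianField p σ P Z) (hσ : σ ≠ 0)
    (hp : ∀ m d, 0 < p m d) {a : ℝ} (ha : a < rate ψ σ x) :
    ∃ U ∈ 𝓝 x.1, ∃ W ∈ 𝓝 x.2, ∀ᵐ ω ∂P, ∀ᶠ t : ℕ in atTop,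
      (hitCount (typeClass p t U) W (Z t · ω) : ℝ) ≤ Real.exp (t * (Real.log ψ - a)) := by
  by_cases hν : x.1 ∈ typeSet Δ
  swap
  · obtain ⟨U, hU, hempty⟩ := exists_nhds_typeClass_eq_empty p hν
    refine ⟨U, hU, Set.univ, univ_mem, ae_of_all _ fun ω => ?_⟩
    filter_upwards [hempty] with t ht
    rw [hitCount_eq_zero (by simp [ht]), Nat.cast_zero]
    exact (Real.exp_pos _).le
  rcases le_or_gt (gaussRate σ x.1 x.2) (totalEntropy x.1) with hJ | hJ
  · rw [rate_of_mem ψ ⟨hν, hJ⟩, EReal.coe_lt_coe_iff] at ha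
    obtain ⟨U, hU, W, hW, hlt⟩ := hZ.exists_nhds_ae_hitCount_lt (ξ := x.2) hσ hp hν
      (a := Real.log ψ - a) (by linarith)
    exact ⟨U, hU, W, hW, hlt.mono fun ω hω => hω.mono fun t => le_of_lt⟩
  · obtain ⟨U, hU, W, hW, hlt⟩ := hZ.exists_nhds_ae_hitCount_lt (ξ := x.2) hσ hp hν
      (a := 0) (by linarith)
    refine ⟨U, hU, W, hW, hlt.mono fun ω hω => hω.mono fun t ht => ?_⟩
    rw [mul_zero, Real.exp_zero, Nat.cast_lt_one] at ht
    rw [ht, Nat.cast_zero]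
    exact (Real.exp_pos _).le

theorem exists_nhds_ae_expGrowthSup_empMeasure_le (hZ : IsGaussianField p σ P Z) (hσ : σ ≠ 0)
    (hp : ∀ m d, 0 < p m d) (hψ : 0 < ψ) (hroot : ψ ^ Δ = ∑ i ∈ Finset.range Δ, ψ ^ i)
    {a : ℝ} (ha : a < rate ψ σ x) :
    ∃ A ∈ 𝓝 x, ∀ᵐ ω ∂P, expGrowthSup (fun t => empMeasure p t (Z t · ω) A) ≤ -(a : EReal) := by
  obtain ⟨U, hU, W, hW, hhit⟩ := hZ.exists_nhds_ae_hitCount_le hσ hp ha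
  refine ⟨U ×ˢ W, prod_mem_nhds hU hW, ?_⟩
  filter_upwards [hhit] with ω hω
  calc expGrowthSup (fun t => empMeasure p t (Z t · ω) (U ×ˢ W))
      ≤ expGrowthSup (fun t => (hitCount (typeClass p t U) W (Z t · ω) : ENNReal)) -
          Real.log ψ := expGrowthSup_empMeasure_prod_le hp hψ hroot
    _ ≤ (Real.log ψ - a : ℝ) - Real.log ψ :=
      EReal.sub_le_sub (expGrowthSup_natCast_le hω) le_rfl
    _ = -(a : EReal) := by rw [← EReal.coe_sub, sub_sub_cancel_left, EReal.coe_neg]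

theorem ae_eventually_abs_lt (hZ : IsGaussianField p σ P Z) (hp : ∀ m d, 0 < p m d)
    (hψ : 0 < ψ) (hroot : ψ ^ Δ = ∑ i ∈ Finset.range Δ, ψ ^ i) {R : ℝ} (hR : 0 ≤ R)
    (hlog : Real.log ψ < R ^ 2 / (2 * σ ^ 2)) :
    ∀ᵐ ω ∂P, ∀ᶠ t : ℕ in atTop, ∀ s ∈ feasible p t, |Z t s ω| < R := by
  have hhit : ∀ᵐ ω ∂P, ∀ᶠ t : ℕ in atTop,
      (hitCount (feasible p t) {z | R ≤ |z|} (Z t · ω) : ℝ) < Real.exp (t * 0) := by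
    refine ae_eventually_hitCount_lt (h := Real.log ψ) (j := R ^ 2 / (2 * σ ^ 2)) ?_
      (isClosed_le continuous_const continuous_abs).measurableSet zero_le_two (sub_neg.2 hlog)
      ?_ ?_ <;>
      filter_upwards [eventually_ge_atTop 1] with t ht
    · exact fun s hs => (hZ t ht s hs).aemeasurable
    · exact card_feasible_le hp hψ hroot ht
    · intro s hs
      simpa only [mul_one] using hZ.measureReal_le_abs_le ht hs (fracState2_le_one s) hR
  filter_upwards [hhit] with ω hω
  filter_upwards [hω] with t ht s hs
  rw [mul_zero, Real.exp_zero, Nat.cast_lt_one] at ht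
  exact not_le.1 fun hle => (hitCount_pos hs hle).ne' ht

theorem exists_isCompact_ae_empMeasure_compl_eq_zero (hZ : IsGaussianField p σ P Z) (hσ : σ ≠ 0)
    (hp : ∀ m d, 0 < p m d) (hψ : 0 < ψ) (hroot : ψ ^ Δ = ∑ i ∈ Finset.range Δ, ψ ^ i) :
    ∃ K : Set ((Fin 2 → Fin Δ → ℝ) × ℝ), IsCompact K ∧ ∀ᵐ ω ∂P, ∀ᶠ t : ℕ in atTop,
      empMeasure p t (Z t · ω) Kᶜ = 0 := by
  obtain ⟨R, hR, hlog⟩ : ∃ R : ℝ, 0 ≤ R ∧ Real.log ψ < R ^ 2 / (2 * σ ^ 2) := by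
    have hlim : Tendsto (fun R : ℝ => R ^ 2 / (2 * σ ^ 2)) atTop atTop :=
      (tendsto_pow_atTop two_ne_zero).atTop_div_const (by positivity)
    exact ((eventually_ge_atTop 0).and (hlim.eventually_gt_atTop _)).exists
  refine ⟨Set.Icc 0 1 ×ˢ Set.Icc (-R) R, isCompact_Icc.prod isCompact_Icc, ?_⟩
  filter_upwards [hZ.ae_eventually_abs_lt hp hψ hroot hR hlog] with ω hω
  filter_upwards [hω] with t ht
  rw [empMeasure, Measure.smul_apply, Measure.finsetSum_apply, Finset.sum_eq_zero, smul_zero]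
  intro s hs
  rw [Measure.dirac_apply, Set.indicator_of_notMem]
  exact fun hmem => hmem ⟨⟨seqType_nonneg s, seqType_le_one s⟩, abs_le.1 (ht s hs).le⟩

end IsGaussianField

section LowerBound

open ExpGrowth

variable {Δ : ℕ} {p : Fin 2 → Fin Δ → ℝ} {ψ : ℝ}

theorem le_expGrowthInf_empMeasure (hp : ∀ m d, 0 < p m d) (hψ : 0 < ψ)
    (hroot : ψ ^ Δ = ∑ i ∈ Finset.range Δ, ψ ^ i) {z : (t : ℕ) → (Fin t → Fin 2) → ℝ}
    {U : Set (Fin 2 → Fin Δ → ℝ)} {W : Set ℝ} {E : Set ((Fin 2 → Fin Δ → ℝ) × ℝ)}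
    (hE : U ×ˢ W ⊆ E) {κ c b : ℝ} (hκ : 0 < κ) (hb : Real.log ψ - c ≤ b)
    (hhit : ∀ᶠ t : ℕ in atTop, κ * Real.exp (t * c) ≤ hitCount (typeClass p t U) W (z t)) :
    -(b : EReal) ≤ expGrowthInf (fun t => empMeasure p t (z t) E) :=
  calc -(b : EReal) ≤ (c : EReal) - Real.log ψ := by
        rw [← EReal.coe_neg, ← EReal.coe_sub, EReal.coe_le_coe_iff]; linarith
    _ ≤ expGrowthInf (fun t => (hitCount (typeClass p t U) W (z t) : ENNReal)) - Real.log ψ :=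
      EReal.sub_le_sub (le_expGrowthInf_natCast hκ hhit) le_rfl
    _ ≤ expGrowthInf (fun t => empMeasure p t (z t) (U ×ˢ W)) :=
      le_expGrowthInf_empMeasure_prod hp hψ hroot
    _ ≤ expGrowthInf (fun t => empMeasure p t (z t) E) :=
      expGrowthInf_monotone fun t => measure_mono hE

end LowerBound

namespace IsGaussianField

open ExpGrowth

variable {Δ : ℕ} {p : Fin 2 → Fin Δ → ℝ} {σ ψ : ℝ} {Ω : Type*} [MeasurableSpace Ω]
  {P : Measure Ω} [IsProbabilityMeasure P] {Z : (t : ℕ) → (Fin t → Fin 2) → Ω → ℝ}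
  {ν : Fin 2 → Fin Δ → ℝ} {ξ : ℝ} {x : (Fin 2 → Fin Δ → ℝ) × ℝ}

theorem ae_le_expGrowthInf_empMeasure_of_gaussRate_lt (hZ : IsGaussianField p σ P Z)
    (hind : ∀ t, 1 ≤ t →
      (feasible p t : Set (Fin t → Fin 2)).Pairwise fun s s' => IndepFun (Z t s) (Z t s') P)
    (hσ : σ ≠ 0) (hp : ∀ m d, 0 < p m d) (hψ : 0 < ψ)
    (hroot : ψ ^ Δ = ∑ i ∈ Finset.range Δ, ψ ^ i) (hx : x.1 ∈ typeSet Δ)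
    (hJ : gaussRate σ x.1 x.2 < totalEntropy x.1) {b : ℝ}
    (hb : Real.log ψ - totalEntropy x.1 + gaussRate σ x.1 x.2 < b)
    {E : Set ((Fin 2 → Fin Δ → ℝ) × ℝ)} (hE : E ∈ 𝓝 x) :
    ∀ᵐ ω ∂P, -(b : EReal) ≤ expGrowthInf (fun t => empMeasure p t (Z t · ω) E) := by
  obtain ⟨U₁, W, hU₁, hxU, hW, hxW, hUW⟩ := mem_nhds_prod_iff'.1 hE
  obtain ⟨j, h, hjJ, hhH, hjh, hjhb⟩ : ∃ j h, gaussRate σ x.1 x.2 < j ∧ h < totalEntropy x.1 ∧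
      j < h ∧ Real.log ψ - (h - j) ≤ b := by
    obtain ⟨c, hc, hcH⟩ := exists_between (max_lt (sub_pos.2 hJ) (show Real.log ψ - b <
      totalEntropy x.1 - gaussRate σ x.1 x.2 by linarith))
    obtain ⟨hc0, hcb⟩ := max_lt_iff.1 hc
    exact ⟨gaussRate σ x.1 x.2 + (totalEntropy x.1 - gaussRate σ x.1 x.2 - c) / 2,
      totalEntropy x.1 - (totalEntropy x.1 - gaussRate σ x.1 x.2 - c) / 2,
      by linarith, by linarith, by linarith, by linarith⟩
  obtain ⟨κ, hκ, U₂, hU₂, hprob⟩ := hZ.exists_nhds_le_measureReal hσ hx hjJ (hW.mem_nhds hxW)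
  have hhit := ae_eventually_le_hitCount (G := fun t => typeClass p t (U₁ ∩ U₂)) (h := h) (j := j)
    (hZ.eventually_aemeasurable_typeClass _)
    ((eventually_ge_atTop 1).mono fun t ht => (hind t ht).mono fun s hs => (mem_typeClass.1 hs).1)
    hW.measurableSet hκ hjh
    (eventually_le_card_typeClass hp hx (inter_mem (hU₁.mem_nhds hxU) hU₂) hhH)
    ((eventually_ge_atTop 1).mono fun t ht s hs =>
      hprob t ht s (monotone_typeClass p t Set.inter_subset_right hs))
  filter_upwards [hhit] with ω hω
  refine le_expGrowthInf_empMeasure hp hψ hroot (U := U₁ ∩ U₂)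
    ((Set.prod_mono Set.inter_subset_left subset_rfl).trans hUW) (half_pos hκ) hjhb ?_
  simpa only [div_mul_eq_mul_div] using hω

theorem ae_eventually_exists_mem_typeClass_abs_lt (hZ : IsGaussianField p σ P Z) (hσ : σ ≠ 0)
    (hp : ∀ m d, 0 < p m d) (hν : ν ∈ typeSet Δ) {U : Set (Fin 2 → Fin Δ → ℝ)} (hU : U ∈ 𝓝 ν)
    {δ : ℝ} (hδ : 0 < δ) :
    ∀ᵐ ω ∂P, ∀ᶠ t : ℕ in atTop, ∃ s ∈ typeClass p t U, |Z t s ω| < δ := by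
  have hnone : ∀ᶠ t : ℕ in atTop, P.real {ω | ∀ s ∈ typeClass p t U, δ ≤ |Z t s ω|} ≤
      2 * Real.exp (-(t * (δ ^ 2 / (2 * σ ^ 2)))) := by
    filter_upwards [eventually_le_card_typeClass hp hν hU (sub_one_lt _), eventually_ge_atTop 1]
      with t hcard ht
    obtain ⟨s, hs⟩ : (typeClass p t U).Nonempty :=
      Finset.card_pos.1 (Nat.cast_pos.1 ((Real.exp_pos _).trans_le hcard))
    have hsub : {ω | ∀ s ∈ typeClass p t U, δ ≤ |Z t s ω|} ⊆ {ω | δ ≤ |Z t s ω|} :=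
      Set.ofPred_subset_ofPred.2 fun ω hω => hω s hs
    refine (measureReal_mono hsub).trans ?_
    simpa only [mul_one] using
      hZ.measureReal_le_abs_le ht (mem_typeClass.1 hs).1 (fracState2_le_one s) hδ.le
  filter_upwards [ae_eventually_notMem_of_eventually_le_exp (by positivity) hnone] with ω hω
  filter_upwards [hω] with t ht
  simpa only [Set.mem_ofPred_eq, not_forall, not_le, exists_prop] using ht

theorem ae_le_expGrowthInf_empMeasure_of_eq_zero (hZ : IsGaussianField p σ P Z) (hσ : σ ≠ 0)
    (hp : ∀ m d, 0 < p m d) (hψ : 0 < ψ) (hroot : ψ ^ Δ = ∑ i ∈ Finset.range Δ, ψ ^ i)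
    (hν : ν ∈ typeSet Δ) {b : ℝ} (hb : Real.log ψ ≤ b) {E : Set ((Fin 2 → Fin Δ → ℝ) × ℝ)}
    (hE : E ∈ 𝓝 (ν, (0 : ℝ))) :
    ∀ᵐ ω ∂P, -(b : EReal) ≤ expGrowthInf (fun t => empMeasure p t (Z t · ω) E) := by
  obtain ⟨U, hU, W, hW, hUW⟩ := mem_nhds_prod_iff.1 hE
  obtain ⟨δ, hδ, hball⟩ := Metric.mem_nhds_iff.1 hW
  filter_upwards [hZ.ae_eventually_exists_mem_typeClass_abs_lt hσ hp hν hU hδ] with ω hω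
  refine le_expGrowthInf_empMeasure hp hψ hroot hUW one_pos (c := 0) (by rwa [sub_zero]) ?_
  filter_upwards [hω] with t ⟨s, hs, hlt⟩
  rw [mul_zero, Real.exp_zero, one_mul, Nat.one_le_cast]
  exact hitCount_pos hs (hball (mem_ball_zero_iff.2 hlt))

theorem ae_le_expGrowthInf_empMeasure (hZ : IsGaussianField p σ P Z)
    (hind : ∀ t, 1 ≤ t →
      (feasible p t : Set (Fin t → Fin 2)).Pairwise fun s s' => IndepFun (Z t s) (Z t s') P)
    (hσ : σ ≠ 0) (hp : ∀ m d, 0 < p m d) (hψ : 0 < ψ)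
    (hroot : ψ ^ Δ = ∑ i ∈ Finset.range Δ, ψ ^ i) {b : ℝ} (hb : rate ψ σ x < b)
    {E : Set ((Fin 2 → Fin Δ → ℝ) × ℝ)} (hE : E ∈ 𝓝 x) :
    ∀ᵐ ω ∂P, -(b : EReal) ≤ expGrowthInf (fun t => empMeasure p t (Z t · ω) E) := by
  have hx : x ∈ rateDomain Δ σ := by
    by_contra hx
    exact not_top_lt (rate_of_notMem ψ hx ▸ hb)
  rw [rate_of_mem ψ hx, EReal.coe_lt_coe_iff] at hb
  obtain ⟨ν, ξ⟩ := x
  obtain ⟨hν, hJ⟩ : ν ∈ typeSet Δ ∧ gaussRate σ ν ξ ≤ totalEntropy ν := hx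
  rcases hJ.lt_or_eq with hlt | heq
  · exact hZ.ae_le_expGrowthInf_empMeasure_of_gaussRate_lt hind hσ hp hψ hroot hν hlt hb hE
  rw [heq, sub_add_cancel] at hb
  rcases eq_or_ne ξ 0 with rfl | hξ
  · exact hZ.ae_le_expGrowthInf_empMeasure_of_eq_zero hσ hp hψ hroot hν hb.le hE
  -- On the boundary `J = H` of the domain, shrinking `ξ` leads into its interior.
  have hscale : Tendsto (fun r : ℝ => (ν, r * ξ)) (𝓝[<] 1) (𝓝 (ν, ξ)) := by
    have hcont : Continuous fun r : ℝ => (ν, r * ξ) := by fun_prop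
    simpa only [one_mul] using (hcont.tendsto 1).mono_left nhdsWithin_le_nhds
  obtain ⟨r, hEr, hr0, hr1⟩ := ((hscale.eventually (eventually_mem_nhds_iff.2 hE)).and
    (Ioo_mem_nhdsLT one_pos)).exists
  have hJr : gaussRate σ ν (r * ξ) < totalEntropy ν := by
    rw [gaussRate_mul, ← heq]
    exact mul_lt_of_lt_one_left (gaussRate_pos hσ hν hξ) (pow_lt_one₀ hr0.le hr1 two_ne_zero)
  exact hZ.ae_le_expGrowthInf_empMeasure_of_gaussRate_lt hind hσ hp hψ hroot (x := (ν, r * ξ)) hν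
    hJr (by dsimp only; linarith) hEr

end IsGaussianField

end RandomDuration

end

theorem theorem2_general {Δ : ℕ} (p : Fin 2 → Fin Δ → ℝ) (hp_pos : ∀ m d, 0 < p m d)
    (ψ : ℝ) (hψ_pos : 0 < ψ) (hψ_root : ψ ^ Δ = ∑ i ∈ Finset.range Δ, ψ ^ i)
    (σ : ℝ) (hσ : σ ≠ 0)
    {Ω : Type*} [MeasurableSpace Ω] (P : Measure Ω) [IsProbabilityMeasure P]
    (Z : (t : ℕ) → (Fin t → Fin 2) → Ω → ℝ)
    (hZ_indep : ∀ t, 1 ≤ t → (RandomDuration.feasible p t : Set (Fin t → Fin 2)).Pairwise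
      fun s s' => IndepFun (Z t s) (Z t s') P)
    (hZ_law : RandomDuration.IsGaussianField p σ P Z) :
    RandomDuration.SatisfiesLDPAlmostSurely P
      (fun t ω => RandomDuration.empMeasure p t fun s => Z t s ω)
      (RandomDuration.rate ψ σ) where
  nonneg := RandomDuration.rate_nonneg hψ_pos hψ_root σ
  lowerSemicontinuous := RandomDuration.lowerSemicontinuous_rate ψ hσ
  upper _ hF := by
    obtain ⟨K, hK, hQK⟩ := hZ_law.exists_isCompact_ae_empMeasure_compl_eq_zero hσ hp_pos
      hψ_pos hψ_root
    exact RandomDuration.ae_expGrowthSup_le_of_isClosed hK hQK (fun _ _ ha =>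
      hZ_law.exists_nhds_ae_expGrowthSup_empMeasure_le hσ hp_pos hψ_pos hψ_root ha) hF
  lower _ hE := RandomDuration.ae_le_expGrowthInf_of_isOpen (fun _ _ hb _ hE =>
    hZ_law.ae_le_expGrowthInf_empMeasure hZ_indep hσ hp_pos hψ_pos hψ_root hb hE) hE

theorem theorem2 {Δ : ℕ} (p : Fin 2 → Fin Δ → ℝ)
    (hp_pos : ∀ m d, 0 < p m d) (hp_sum : ∀ m, ∑ d, p m d = 1)
    (ψ : ℝ) (hψ_pos : 0 < ψ) (hψ_root : ψ ^ Δ = ∑ i ∈ Finset.range Δ, ψ ^ i)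
    (σ : ℝ) (hσ : 0 < σ)
    {Ω : Type*} [MeasurableSpace Ω] (P : Measure Ω) [IsProbabilityMeasure P]
    (Z : (t : ℕ) → (Fin t → Fin 2) → Ω → ℝ)
    (hZ_indep : ∀ t, 1 ≤ t →
      iIndepFun (fun s : {s // s ∈ RandomDuration.feasible p t} => Z t s.1) P)
    (hZ_law : ∀ t, 1 ≤ t → ∀ s ∈ RandomDuration.feasible p t,
      HasLaw (Z t s) (gaussianReal 0 (σ ^ 2 * RandomDuration.fracState2 s / t).toNNReal) P) :
    RandomDuration.SatisfiesLDPAlmostSurely P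
      (fun t ω => RandomDuration.empMeasure p t fun s => Z t s ω)
      (RandomDuration.rate ψ σ) :=
  theorem2_general p hp_pos ψ hψ_pos hψ_root σ hσ.ne' P Z (fun t ht s hs s' hs' hne =>
    (hZ_indep t ht).indepFun (i := ⟨s, hs⟩) (j := ⟨s', hs'⟩) fun h => hne (congrArg Subtype.val h))
    hZ_law
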